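/- For $V>0$ and parameters $u,v>0$, $x,y,z\in\mathbb R$, let $C=2^{1/3}V^{2/3}$ and let $L_V(u,v,x,y,z)=\mathbb Z v_1\oplus\mathbb Z v_2\oplus\mathbb Z v_3\subset\mathbb R^3$ be the Bravais lattice of volume $V$ with basis $$v_1=\sqrt C\Big(\tfrac1{\sqrt u},0,0\Big),\quad v_2=\sqrt C\Big(\tfrac{x}{\sqrt u},\tfrac{v}{\sqrt u},0\Big),\quad v_3=\sqrt C\Big(\tfrac{y}{\sqrt u},\tfrac{vz}{\sqrt u},\tfrac{u}{v\sqrt2}\Big).$$ Up to a linear isometry, every Bravais lattice of volume $V$ is of this form. For $\alpha>0$ let $f_\alpha(r)=e^{-\alpha r}$ and $E_{f_\alpha}[L]=\sum_{p\in L\setminus\{0\}}e^{-\alpha|p|^2}$. A Bravais lattice $L$ of volume $1$ is called a *local minimizer* of $E_{f_\alpha}$ among Bravais lattices of fixed volume $1$ if every $(u,v,x,y,z)$ with $L_1(u,v,x,y,z)$ isometric to $L$ is a local minimizer of the function $(u,v,x,y,z)\mapsto E_{f_\alpha}[L_1(u,v,x,y,z)]$; it is called a *saddle point* if every such $(u,v,x,y,z)$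 is a critical point of that function which is neither a local minimizer nor a local maximizer. Let $D_3=L_1(1,1,0,\tfrac12,\tfrac12)$ be the FCC lattice of volume $1$, and let the BCC lattice $D_3^*=\{q\in\mathbb R^3:\ q\cdot p\in\mathbb Z\ \text{for all } p\in D_3\}$ be its dual. Consider, for $\alpha_0,\alpha_1>0$, the two properties (i) for any $0<\alpha<\alpha_0$, $D_3$ is a saddle point of $E_{f_\alpha}$ among Bravais lattices of fixed volume $1$; (ii) for any $\alpha>\alpha_1$, $D_3$ is a local minimizer of $E_{f_\alpha}$ among Bravais lattices of fixed volume $1$. Then: (A) There exist $\alpha_0>0$ and $\alpha_1>0$ satisfying (i) and (ii) such that 1. for any $\alpha>1/\alpha_0$, $D_3^*$ is a saddle point of $E_{f_\alpha}$ among Bravais lattices of fixed volume $1$; 2. for any $0<\alpha<1/\alpha_1$, $D_3^*$ is a local minimizer of $E_{f_\alpha}$ among Bravais lattices of fixed volume $1$. (B) For every $\alpha_0>0$ satisfying (i), $D_3^*$ is a saddle point of $E_{f_\alpha}$ among Bravais lattices of fixed volume $1$ for any $\alpha>\pi^2/\alpha_0$; and for every $\alpha_1>0$ satisfying (ii), $D_3^*$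 is a local minimizer of $E_{f_\alpha}$ among Bravais lattices of fixed volume $1$ for any $0<\alpha<\pi^2/\alpha_1$. -/

import Mathlib

noncomputable section

namespace CubicLattices

/-- Euclidean three-space. -/
abbrev E3 : Type := EuclideanSpace ℝ (Fin 3)

/-- The admissible parameters `q = (u, v, x, y, z)`: those with `u > 0` and `v > 0`. -/
def paramDomain : Set (Fin 5 → ℝ) := {q | 0 < q 0 ∧ 0 < q 1}

/-- The constant `C = V^(2/3) * 2^(1/3)`. -/
def latConst (V : ℝ) : ℝ := V ^ (2 / 3 : ℝ) * 2 ^ (1 / 3 : ℝ)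

/-- The basis vectors `v₁, v₂, v₃` attached to the volume `V` and the parameters
`q = (u, v, x, y, z)`. -/
def basisVec (V : ℝ) (q : Fin 5 → ℝ) : Fin 3 → E3 :=
  ![Real.sqrt (latConst V) • !₂[1 / Real.sqrt (q 0), 0, 0],
    Real.sqrt (latConst V) • !₂[q 2 / Real.sqrt (q 0), q 1 / Real.sqrt (q 0), 0],
    Real.sqrt (latConst V) •
      !₂[q 3 / Real.sqrt (q 0), q 1 * q 4 / Real.sqrt (q 0), q 0 / (q 1 * Real.sqrt 2)]]

/-- The Bravais lattice `ℤ v₁ + ℤ v₂ + ℤ v₃` of volume `V` with parameters `q`. -/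
def paramLattice (V : ℝ) (q : Fin 5 → ℝ) : Submodule ℤ E3 :=
  Submodule.span ℤ (Set.range (basisVec V q))

/-- The `f`-energy `E_f[L] = ∑_{p ∈ L, p ≠ 0} f (|p|²)`. -/
def latticeEnergy (f : ℝ → ℝ) (L : Submodule ℤ E3) : ℝ :=
  ∑' p : {p : E3 // p ∈ L ∧ p ≠ 0}, f (‖(p : E3)‖ ^ 2)

/-- The energy as a function of the five parameters, at fixed volume `V`. -/
def paramEnergy (f : ℝ → ℝ) (V : ℝ) (q : Fin 5 → ℝ) : ℝ :=
  latticeEnergy f (paramLattice V q)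

/-- `q` parametrizes `L` (up to a linear isometry of the ambient space) as a lattice of
volume `V`. -/
def Parametrizes (V : ℝ) (q : Fin 5 → ℝ) (L : Submodule ℤ E3) : Prop :=
  q ∈ paramDomain ∧ ∃ O : E3 ≃ₗᵢ[ℝ] E3, O '' (paramLattice V q : Set E3) = (L : Set E3)

/-- The parameter point `q` is a local minimizer of the energy at fixed volume `V`. -/
def IsLocalMinParam (f : ℝ → ℝ) (V : ℝ) (q : Fin 5 → ℝ) : Prop :=
  IsLocalMin (paramEnergy f V) q

/-- The parameter point `q` is a saddle point of the energy at fixed volume `V`: the energy is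
differentiable there with zero gradient, and `q` is neither a local minimizer nor a local
maximizer. -/
def IsSaddleParam (f : ℝ → ℝ) (V : ℝ) (q : Fin 5 → ℝ) : Prop :=
  HasFDerivAt (paramEnergy f V) (0 : (Fin 5 → ℝ) →L[ℝ] ℝ) q ∧
    ¬ IsLocalMin (paramEnergy f V) q ∧ ¬ IsLocalMax (paramEnergy f V) q

/-- `L` is a local minimizer of `E_f` among Bravais lattices of volume `V`: it is such a lattice,
and this holds at each of its parametrizations. -/
def IsLocalMinimizer (f : ℝ → ℝ) (V : ℝ) (L : Submodule ℤ E3) : Prop :=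
  (∃ q, Parametrizes V q L) ∧ ∀ q, Parametrizes V q L → IsLocalMinParam f V q

/-- `L` is a saddle point of `E_f` among Bravais lattices of volume `V`: it is such a lattice,
and this holds at each of its parametrizations. -/
def IsSaddlePoint (f : ℝ → ℝ) (V : ℝ) (L : Submodule ℤ E3) : Prop :=
  (∃ q, Parametrizes V q L) ∧ ∀ q, Parametrizes V q L → IsSaddleParam f V q

/-- The potential `f_α (r) = exp (-α r)`. -/
def gaussPotential (α : ℝ) (r : ℝ) : ℝ := Real.exp (-α * r)

/-- The FCC lattice `D₃` of volume `V`, with parameters `(1, 1, 0, 1/2, 1/2)`. -/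
def fcc (V : ℝ) : Submodule ℤ E3 := paramLattice V ![1, 1, 0, 1 / 2, 1 / 2]

/-- The dual lattice `{x | ∀ y ∈ L, ⟪x, y⟫ ∈ ℤ}`. -/
def dualLattice (L : Submodule ℤ E3) : Submodule ℤ E3 :=
  LinearMap.BilinForm.dualSubmodule (innerₗ E3) L

/-- The BCC lattice `D₃*` of volume one, the dual of the FCC lattice of volume one. -/
def bcc : Submodule ℤ E3 := dualLattice (fcc 1)

end CubicLattices

end

noncomputable section

namespace CubicLattices

open Real Filter Topology Matrix

/-! ### Twisted Poisson summation for Gaussians on the line -/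

/-! Two mechanisms carry the theorem: theta-function duality, and a symmetry-based second order
expansion for large `α`.

Duality. Poisson summation gives `1 + E_α[L] = (π/α)^(3/2) (1 + E_{π²/α}[L*])` for `L` of volume one
(`paramEnergy_dual`). On parameters, `L ↦ L*` is the involution `dualParam`, differentiable on the
parameter domain, so local extremality and criticality at `L` for `π²/α` pass to `L*` for `α`
(`IsLocalMinimizer.dual`, `IsSaddlePoint.dual`). This is (B). For (A) it is then enough to show
that, for large `α`, FCC is a local minimizer and BCC is a saddle point: dualizing the BCC statement
gives the FCC saddle for small `α`, and `π² ≥ 1` lets the weaker reciprocals `1/α₀`, `1/α₁` serve.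

Large `α`. In suitable coordinates (`Frame`) the lattice is a set of integer vectors with the
symmetry of the cube, and nearby lattices correspond to forms `1 + K` with `K` symmetric and `det (1
+ K) = 1`. By symmetry the linear term of the energy is proportional to `tr K`, and the determinant
condition makes `tr K` quadratic in `K`; hence the point is critical. The change of energy is
exactly a nonnegative sum of remainders minus `β tr K` times a second moment (`hasSum_expRem`). The
remainder from the shortest vectors has size `β² e^{-βm}`, the trace term only `β e^{-βm}`, where
`m` is the minimal squared length. For FCC the shortest vectors detect every `K`, so the remainder
wins. For BCC they are the vectors `(±1, ±1, ±1)`, which detect a shear but see a nearly traceless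
diagonal `K` only to second order: the energy rises along `shearDir` and falls along `diagDir`. -/

theorem tsum_twisted_gaussian {a : ℝ} (ha : 0 < a) (s t : ℝ) :
    (∑' n : ℤ, Complex.exp (-a * (n + s) ^ 2 + 2 * π * Complex.I * n * t)) =
      (√(π / a) : ℝ) * ∑' m : ℤ,
        Complex.exp (-(π ^ 2 / a) * (m - t) ^ 2 + 2 * π * Complex.I * (m - t) * s) := by
  have hpi : (π : ℂ) ≠ 0 := by exact_mod_cast Real.pi_ne_zero
  have ha' : (a : ℂ) ≠ 0 := by exact_mod_cast ha.ne'
  -- The complex linear coefficient encodes the shift `s` in its real part and the twist `t` in its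
  -- imaginary part; the factor `exp (-a s²)` is split off from both sides.
  have key := Complex.tsum_exp_neg_quadratic (a := ((a / π : ℝ) : ℂ))
    (by rw [Complex.ofReal_re]; positivity) (-(a * s / π) + Complex.I * t)
  have h1 : ∀ n : ℤ, Complex.exp (-a * (n + s) ^ 2 + 2 * π * Complex.I * n * t) =
      Complex.exp (-(a * s ^ 2)) * Complex.exp (-π * ((a / π : ℝ) : ℂ) * n ^ 2 +
        2 * π * (-(a * s / π) + Complex.I * t) * n) := by
    intro n
    rw [← Complex.exp_add]
    congr 1
    push_cast
    field_simp
    ring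
  have h2 : ∀ m : ℤ,
      Complex.exp (-(π ^ 2 / a) * (m - t) ^ 2 + 2 * π * Complex.I * (m - t) * s) =
      Complex.exp (-(a * s ^ 2)) * Complex.exp (-π / ((a / π : ℝ) : ℂ) *
        (m + Complex.I * (-(a * s / π) + Complex.I * t)) ^ 2) := by
    intro m
    rw [← Complex.exp_add]
    congr 1
    push_cast
    have hI : Complex.I ^ 2 = -1 := Complex.I_sq
    have e : (m + Complex.I * (-(a * s / π) + Complex.I * t) : ℂ) =
        (m - t) - Complex.I * (a * s / π) := by
      linear_combination (t : ℂ) * hI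
    rw [e]
    have e2 : (((m : ℂ) - t) - Complex.I * (a * s / π)) ^ 2 =
        (m - t) ^ 2 - 2 * Complex.I * (m - t) * (a * s / π) - (a * s / π) ^ 2 := by
      linear_combination ((a * s / π) ^ 2 : ℂ) * hI
    rw [e2]
    field_simp
    ring
  have h3 : (1 / ((a / π : ℝ) : ℂ) ^ (1 / 2 : ℂ)) = ((√(π / a) : ℝ) : ℂ) := by
    have : (1 / 2 : ℂ) = ((1 / 2 : ℝ) : ℂ) := by push_cast; ring
    rw [this, ← Complex.ofReal_cpow (by positivity), ← Real.sqrt_eq_rpow, ← Complex.ofReal_one,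
      ← Complex.ofReal_div]
    congr 1
    rw [one_div, ← Real.sqrt_inv, inv_div]
  simp_rw [h1, h2, tsum_mul_left]
  rw [key, h3]
  ring

/-! ### Summability of Gaussians -/

theorem summable_exp_neg_mul_int_sq {c : ℝ} (hc : 0 < c) :
    Summable fun n : ℤ => Real.exp (-c * (n : ℝ) ^ 2) := by
  have h := (summable_jacobiTheta₂_term_iff 0 (((c / π : ℝ) : ℂ) * Complex.I)).2
    (by simp only [Complex.mul_I_im, Complex.ofReal_re]; positivity)
  refine h.norm.congr fun n => ?_
  rw [jacobiTheta₂_term, Complex.norm_exp]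
  congr 1
  have hpi : (π : ℂ) ≠ 0 := by exact_mod_cast Real.pi_ne_zero
  have : (2 * π * Complex.I * n * 0 + π * Complex.I * n ^ 2 * (((c / π : ℝ) : ℂ) * Complex.I) : ℂ)
      = ((-c * (n : ℝ) ^ 2 : ℝ) : ℂ) := by
    push_cast
    field_simp
    linear_combination (c * n ^ 2 : ℂ) * Complex.I_sq
  rw [this, Complex.ofReal_re]

/-- Triples of integers, the last coordinate first. -/
def tripleEquiv : ℤ × ℤ × ℤ ≃ (Fin 3 → ℤ) where
  toFun p := ![p.2.2, p.2.1, p.1]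
  invFun n := (n 2, n 1, n 0)
  left_inv p := by simp
  right_inv n := by ext i; fin_cases i <;> rfl

theorem tsum_triple {E : Type*} [NormedAddCommGroup E] [CompleteSpace E]
    {f : (Fin 3 → ℤ) → E} (hf : Summable f) :
    ∑' n, f n = ∑' n₃ : ℤ, ∑' n₂ : ℤ, ∑' n₁ : ℤ, f ![n₁, n₂, n₃] := by
  have h : Summable fun p : ℤ × ℤ × ℤ => f (tripleEquiv p) := tripleEquiv.summable_iff.2 hf
  rw [← tripleEquiv.tsum_eq, h.tsum_prod]
  refine tsum_congr fun n₃ => ?_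
  exact (h.prod_factor n₃).tsum_prod

/-- The squared length of an integer vector. -/
def normSq (k : Fin 3 → ℤ) : ℝ := (k 0 : ℝ) ^ 2 + (k 1 : ℝ) ^ 2 + (k 2 : ℝ) ^ 2

theorem normSq_nonneg (k : Fin 3 → ℤ) : 0 ≤ normSq k := by
  unfold normSq; positivity

theorem summable_exp_neg_mul_normSq {c : ℝ} (hc : 0 < c) :
    Summable fun k : Fin 3 → ℤ => Real.exp (-c * normSq k) := by
  have h := summable_exp_neg_mul_int_sq hc
  have h3 := h.mul_of_nonneg (h.mul_of_nonneg h (fun _ => (Real.exp_pos _).le)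
    (fun _ => (Real.exp_pos _).le)) (fun _ => (Real.exp_pos _).le)
    (fun _ => mul_nonneg (Real.exp_pos _).le (Real.exp_pos _).le)
  rw [← tripleEquiv.summable_iff]
  refine h3.congr fun p => ?_
  simp only [Function.comp, tripleEquiv, normSq, Equiv.coe_fn_mk, Matrix.cons_val]
  rw [← Real.exp_add, ← Real.exp_add]
  congr 1
  ring

theorem sq_mul_exp_neg_le {y : ℝ} (hy : 0 ≤ y) : y ^ 2 * Real.exp (-y) ≤ 2 := by
  rw [Real.exp_neg, ← div_eq_mul_inv, div_le_iff₀ (Real.exp_pos y)]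
  linarith [Real.quadratic_le_exp_of_nonneg hy]

theorem normSq_sq_mul_exp_le {c : ℝ} (hc : 0 < c) (k : Fin 3 → ℤ) :
    normSq k ^ 2 * Real.exp (-c * normSq k) ≤ 8 / c ^ 2 * Real.exp (-(c / 2) * normSq k) := by
  have h := sq_mul_exp_neg_le (y := c / 2 * normSq k) (mul_nonneg (by positivity) (normSq_nonneg k))
  have e : Real.exp (-c * normSq k) =
      Real.exp (-(c / 2 * normSq k)) * Real.exp (-(c / 2) * normSq k) := by
    rw [← Real.exp_add]; congr 1; ring
  rw [e, ← mul_assoc]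
  refine mul_le_mul_of_nonneg_right ?_ (Real.exp_pos _).le
  rw [le_div_iff₀ (by positivity)]
  nlinarith

theorem summable_normSq_sq_mul_exp {c : ℝ} (hc : 0 < c) :
    Summable fun k : Fin 3 → ℤ => normSq k ^ 2 * Real.exp (-c * normSq k) :=
  Summable.of_nonneg_of_le (fun k => by positivity) (normSq_sq_mul_exp_le hc)
    ((summable_exp_neg_mul_normSq (half_pos hc)).mul_left _)

/-! ### Triangular Gaussian sums -/

/-- The quadratic form `a (n₁ + x n₂ + y n₃)² + b (n₂ + z n₃)² + c n₃²`. -/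
def triForm (a b c x y z : ℝ) (n : Fin 3 → ℤ) : ℝ :=
  a * (n 0 + x * n 1 + y * n 2) ^ 2 + b * (n 1 + z * n 2) ^ 2 + c * (n 2 : ℝ) ^ 2

/-- Back-substitution in the triangular system bounds the coordinates by the three squares. The
constant is crude; only summability depends on it. -/
theorem exists_le_triForm {a b c : ℝ} (ha : 0 < a) (hb : 0 < b) (hc : 0 < c) (x y z : ℝ) :
    ∃ l > 0, ∀ n, l * normSq n ≤ triForm a b c x y z n := by
  obtain ⟨m, hm, hma, hmb, hmc⟩ : ∃ m > 0, m ≤ a ∧ m ≤ b ∧ m ≤ c :=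
    ⟨min a (min b c), by positivity, by simp, by simp, by simp⟩
  -- `M` is the sum of the coefficients that `A ^ 2`, `B ^ 2` and `n 2 ^ 2` acquire after the
  -- substitution.
  set M : ℝ := 3 + 2 * (3 * x ^ 2 + 1) + 2 * z ^ 2 * (3 * x ^ 2 + 1) + 3 * y ^ 2 + 1 with hM
  have hM0 : 0 < M := by positivity
  refine ⟨m / M, by positivity, fun n => ?_⟩
  rw [div_mul_eq_mul_div, div_le_iff₀ hM0]
  set A : ℝ := n 0 + x * n 1 + y * n 2 with hA
  set B : ℝ := n 1 + z * n 2 with hB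
  have h1 : (n 0 : ℝ) ^ 2 ≤ 3 * (A ^ 2 + x ^ 2 * (n 1 : ℝ) ^ 2 + y ^ 2 * (n 2 : ℝ) ^ 2) := by
    have : (n 0 : ℝ) = A - x * n 1 - y * n 2 := by rw [hA]; ring
    rw [this]
    nlinarith [sq_nonneg (A + x * n 1), sq_nonneg (A + y * n 2), sq_nonneg (x * n 1 - y * n 2)]
  have h2 : (n 1 : ℝ) ^ 2 ≤ 2 * (B ^ 2 + z ^ 2 * (n 2 : ℝ) ^ 2) := by
    have : (n 1 : ℝ) = B - z * n 2 := by rw [hB]; ring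
    rw [this]
    nlinarith [sq_nonneg (B + z * n 2)]
  have h3 : normSq n ≤ M * (A ^ 2 + B ^ 2 + (n 2 : ℝ) ^ 2) := by
    have h4 := mul_le_mul_of_nonneg_left h2 (by positivity : 0 ≤ 3 * x ^ 2 + 1)
    unfold normSq
    have e : M * (A ^ 2 + B ^ 2 + (n 2 : ℝ) ^ 2) = 3 * A ^ 2 +
      (3 * x ^ 2 + 1) * (2 * (B ^ 2 + z ^ 2 * (n 2 : ℝ) ^ 2)) + (3 * y ^ 2 + 1) * (n 2 : ℝ) ^ 2
      + ((M - 3) * A ^ 2 + (M - 2 * (3 * x ^ 2 + 1)) * B ^ 2 +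
        (3 + 2 * (3 * x ^ 2 + 1)) * (n 2 : ℝ) ^ 2) := by rw [hM]; ring
    have e2 : 0 ≤ (M - 3) * A ^ 2 + (M - 2 * (3 * x ^ 2 + 1)) * B ^ 2 +
        (3 + 2 * (3 * x ^ 2 + 1)) * (n 2 : ℝ) ^ 2 := by
      have f1 : 0 ≤ M - 3 := by
        rw [hM]; have : 0 ≤ 2 * z ^ 2 * (3 * x ^ 2 + 1) := by positivity
        nlinarith [sq_nonneg x, sq_nonneg y]
      have f2 : 0 ≤ M - 2 * (3 * x ^ 2 + 1) := by
        rw [hM]; have : 0 ≤ 2 * z ^ 2 * (3 * x ^ 2 + 1) := by positivity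
        nlinarith [sq_nonneg x, sq_nonneg y]
      positivity
    nlinarith
  have h4 : m * (A ^ 2 + B ^ 2 + (n 2 : ℝ) ^ 2) ≤ triForm a b c x y z n := by
    unfold triForm
    rw [← hA, ← hB, mul_add, mul_add]
    gcongr
  calc m * normSq n ≤ m * (M * (A ^ 2 + B ^ 2 + (n 2 : ℝ) ^ 2)) := by gcongr
    _ = m * (A ^ 2 + B ^ 2 + (n 2 : ℝ) ^ 2) * M := by ring
    _ ≤ _ := by gcongr

theorem summable_exp_neg_triForm {a b c : ℝ} (ha : 0 < a) (hb : 0 < b) (hc : 0 < c)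
    (x y z : ℝ) : Summable fun n => Real.exp (-triForm a b c x y z n) := by
  obtain ⟨l, hl, h⟩ := exists_le_triForm ha hb hc x y z
  refine Summable.of_nonneg_of_le (fun n => (Real.exp_pos _).le) (fun n => ?_)
    (summable_exp_neg_mul_normSq hl)
  exact Real.exp_le_exp.2 (by linarith [h n])

/-! ### Poisson summation for triangular quadratic forms -/

theorem norm_cexp_real_add_I (r t : ℝ) : ‖Complex.exp (r + 2 * π * Complex.I * t)‖ = Real.exp r := by
  rw [Complex.norm_exp]
  congr 1
  simp

theorem summable_cexp_of_summable_exp {ι : Type*} {r : ι → ℝ} (t : ι → ℝ)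
    (h : Summable fun i => Real.exp (r i)) :
    Summable fun i => Complex.exp (r i + 2 * π * Complex.I * t i) :=
  Summable.of_norm (h.congr fun _ => (norm_cexp_real_add_I _ _).symm)

/-- A shift costs a constant factor and half the decay: `a(n+s)² - (a/2)n² + as² = (a/2)(n+2s)²`. -/
theorem summable_shift_gaussian {a : ℝ} (ha : 0 < a) (s : ℝ) :
    Summable fun n : ℤ => Real.exp (-(a * (n + s) ^ 2)) := by
  refine Summable.of_nonneg_of_le (fun n => (Real.exp_pos _).le) (fun n => ?_)
    ((summable_exp_neg_mul_int_sq (half_pos ha)).mul_left (Real.exp (a * s ^ 2)))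
  rw [← Real.exp_add]
  refine Real.exp_le_exp.2 ?_
  nlinarith [mul_nonneg ha.le (sq_nonneg ((n : ℝ) + 2 * s))]

theorem summable_pair_gaussian {a b : ℝ} (ha : 0 < a) (hb : 0 < b) (x s : ℝ) :
    Summable fun p : ℤ × ℤ =>
      Real.exp (-(a * (p.1 : ℝ) ^ 2) - b * (p.2 - p.1 * x + s) ^ 2) := by
  have hinj : Function.Injective fun p : ℤ × ℤ => (![0, p.2, p.1] : Fin 3 → ℤ) := by
    intro p q hpq
    have h1 := congrFun hpq 1
    have h2 := congrFun hpq 2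
    simp at h1 h2
    exact Prod.ext h2 h1
  have h' := ((summable_exp_neg_triForm one_pos (half_pos hb) ha 0 0 (-x)).comp_injective
    hinj).mul_left (Real.exp (b * s ^ 2))
  refine Summable.of_nonneg_of_le (fun n => (Real.exp_pos _).le) (fun p => ?_) h'
  simp only [Function.comp, triForm, Matrix.cons_val]
  rw [← Real.exp_add]
  refine Real.exp_le_exp.2 ?_
  push_cast
  nlinarith [mul_nonneg hb.le (sq_nonneg ((p.2 : ℝ) - p.1 * x + 2 * s))]

/-- The summand after Poisson summation in the first coordinate. -/
def partialDual₁ (a b c x y z : ℝ) (n₃ n₂ m₁ : ℤ) : ℂ :=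
  Complex.exp (((-(π ^ 2 / a * m₁ ^ 2) - b * (n₂ + z * n₃) ^ 2 - c * n₃ ^ 2 : ℝ) : ℂ) +
    2 * π * Complex.I * ((m₁ * (x * n₂ + y * n₃) : ℝ) : ℂ))

/-- The summand after Poisson summation in the first two coordinates. -/
def partialDual₂ (a b c x y z : ℝ) (n₃ : ℤ) (p : ℤ × ℤ) : ℂ :=
  Complex.exp (((-(π ^ 2 / a * p.1 ^ 2) - π ^ 2 / b * (p.2 - p.1 * x) ^ 2 - c * n₃ ^ 2 : ℝ) : ℂ) +
    2 * π * Complex.I * ((n₃ * (p.1 * y + z * (p.2 - p.1 * x)) : ℝ) : ℂ))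

theorem tsum_exp_neg_triForm_fst {a : ℝ} (ha : 0 < a) (b c x y z : ℝ) (n₃ n₂ : ℤ) :
    ∑' n₁ : ℤ, ((Real.exp (-triForm a b c x y z ![n₁, n₂, n₃]) : ℝ) : ℂ) =
      (√(π / a) : ℝ) * ∑' m₁ : ℤ, partialDual₁ a b c x y z n₃ n₂ m₁ := by
  have h := tsum_twisted_gaussian ha (x * n₂ + y * n₃) 0
  have e1 : ∀ n₁ : ℤ, ((Real.exp (-triForm a b c x y z ![n₁, n₂, n₃]) : ℝ) : ℂ) =
      Complex.exp (-b * (n₂ + z * n₃) ^ 2 - c * n₃ ^ 2) *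
      Complex.exp (-a * (n₁ + ((x * n₂ + y * n₃ : ℝ) : ℂ)) ^ 2 +
        2 * π * Complex.I * n₁ * ((0 : ℝ) : ℂ)) := by
    intro n₁
    rw [← Complex.exp_add, Complex.ofReal_exp]
    congr 1
    simp only [triForm, Matrix.cons_val]
    push_cast
    ring
  simp_rw [e1]
  rw [tsum_mul_left, h, mul_left_comm, ← tsum_mul_left]
  congr 1
  refine tsum_congr fun m => ?_
  rw [← Complex.exp_add, partialDual₁]
  congr 1
  push_cast
  ring

/-- The phase left by the first coordinate is linear in `n₂`; its slope `m₁ x` acts as the twist and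
becomes the centre of the dual Gaussian in `m₂`. -/
theorem tsum_partialDual₁ {b : ℝ} (hb : 0 < b) (a c x y z : ℝ) (m₁ n₃ : ℤ) :
    ∑' n₂ : ℤ, partialDual₁ a b c x y z n₃ n₂ m₁ =
      (√(π / b) : ℝ) * ∑' m₂ : ℤ, partialDual₂ a b c x y z n₃ (m₁, m₂) := by
  have h := tsum_twisted_gaussian hb (z * n₃) (m₁ * x)
  have e1 : ∀ n₂ : ℤ, partialDual₁ a b c x y z n₃ n₂ m₁ =
      Complex.exp (-(π ^ 2 / a) * m₁ ^ 2 - c * n₃ ^ 2 + 2 * π * Complex.I * (m₁ * y * n₃)) *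
      Complex.exp (-b * (n₂ + ((z * n₃ : ℝ) : ℂ)) ^ 2 +
        2 * π * Complex.I * n₂ * ((m₁ * x : ℝ) : ℂ)) := by
    intro n₂
    rw [← Complex.exp_add, partialDual₁]
    congr 1
    push_cast
    ring
  simp_rw [e1]
  rw [tsum_mul_left, h, mul_left_comm, ← tsum_mul_left]
  congr 1
  refine tsum_congr fun m => ?_
  rw [← Complex.exp_add, partialDual₂]
  congr 1
  push_cast
  ring

/-- The last sum has no shift, so no phase survives. The result is the inverse form, which is
triangular in the reversed order of the coordinates. -/
theorem tsum_partialDual₂ {c : ℝ} (hc : 0 < c) (a b x y z : ℝ) (m₁ m₂ : ℤ) :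
    ∑' n₃ : ℤ, partialDual₂ a b c x y z n₃ (m₁, m₂) =
      (√(π / c) : ℝ) * ∑' m₃ : ℤ, ((Real.exp (-triForm (π ^ 2 / c) (π ^ 2 / b) (π ^ 2 / a) (-z)
        (x * z - y) (-x) ![m₃, m₂, m₁]) : ℝ) : ℂ) := by
  have h := tsum_twisted_gaussian hc 0 (m₁ * y + z * (m₂ - m₁ * x))
  have e1 : ∀ n₃ : ℤ, partialDual₂ a b c x y z n₃ (m₁, m₂) =
      Complex.exp (-(π ^ 2 / a) * m₁ ^ 2 - π ^ 2 / b * (m₂ - m₁ * x) ^ 2) *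
      Complex.exp (-c * (n₃ + ((0 : ℝ) : ℂ)) ^ 2 +
        2 * π * Complex.I * n₃ * ((m₁ * y + z * (m₂ - m₁ * x) : ℝ) : ℂ)) := by
    intro n₃
    rw [← Complex.exp_add, partialDual₂]
    congr 1
    push_cast
    ring
  simp_rw [e1]
  rw [tsum_mul_left, h, mul_left_comm, ← tsum_mul_left]
  congr 1
  refine tsum_congr fun m => ?_
  rw [← Complex.exp_add, Complex.ofReal_exp]
  congr 1
  simp only [triForm, Matrix.cons_val]
  push_cast
  ring

theorem summable_partialDual₁ {a b : ℝ} (ha : 0 < a) (hb : 0 < b) (c x y z : ℝ) (n₃ : ℤ) :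
    Summable (Function.uncurry fun m₁ n₂ => partialDual₁ a b c x y z n₃ n₂ m₁) := by
  have ha' : 0 < π ^ 2 / a := by positivity
  refine summable_cexp_of_summable_exp (ι := ℤ × ℤ)
    (r := fun p => -(π ^ 2 / a * p.1 ^ 2) - b * (p.2 + z * n₃) ^ 2 - c * n₃ ^ 2)
    (fun p => p.1 * (x * p.2 + y * n₃)) ?_
  refine (((summable_shift_gaussian ha' 0).mul_of_nonneg (summable_shift_gaussian hb (z * n₃))
    (fun _ => (Real.exp_pos _).le) (fun _ => (Real.exp_pos _).le)).mul_left
    (Real.exp (-c * (n₃ : ℝ) ^ 2))).congr fun p => ?_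
  rw [← Real.exp_add, ← Real.exp_add]
  congr 1
  ring

theorem summable_partialDual₂ {a b c : ℝ} (ha : 0 < a) (hb : 0 < b) (hc : 0 < c) (x y z : ℝ) :
    Summable (Function.uncurry fun p n₃ => partialDual₂ a b c x y z n₃ p) := by
  have ha' : 0 < π ^ 2 / a := by positivity
  have hb' : 0 < π ^ 2 / b := by positivity
  refine summable_cexp_of_summable_exp (ι := (ℤ × ℤ) × ℤ)
    (r := fun p => -(π ^ 2 / a * p.1.1 ^ 2) - π ^ 2 / b * (p.1.2 - p.1.1 * x) ^ 2 - c * p.2 ^ 2)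
    (fun p => p.2 * (p.1.1 * y + z * (p.1.2 - p.1.1 * x))) ?_
  refine ((summable_pair_gaussian ha' hb' x 0).mul_of_nonneg (summable_shift_gaussian hc 0)
    (fun _ => (Real.exp_pos _).le) (fun _ => (Real.exp_pos _).le)).congr fun p => ?_
  rw [← Real.exp_add]
  congr 1
  ring

/-- Poisson summation for a triangular ternary quadratic form. -/
theorem tsum_exp_neg_triForm {a b c : ℝ} (ha : 0 < a) (hb : 0 < b) (hc : 0 < c) (x y z : ℝ) :
    ∑' n, Real.exp (-triForm a b c x y z n) =
      √(π / a) * √(π / b) * √(π / c) *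
        ∑' n, Real.exp (-triForm (π ^ 2 / c) (π ^ 2 / b) (π ^ 2 / a) (-z) (x * z - y) (-x) n) := by
  have hS := summable_exp_neg_triForm ha hb hc x y z
  have hT := summable_exp_neg_triForm (a := π ^ 2 / c) (b := π ^ 2 / b) (c := π ^ 2 / a)
    (by positivity) (by positivity) (by positivity) (-z) (x * z - y) (-x)
  have hSC : Summable fun n => ((Real.exp (-triForm a b c x y z n) : ℝ) : ℂ) :=
    Complex.ofRealCLM.summable hS
  have hTC : Summable fun n => ((Real.exp (-triForm (π ^ 2 / c) (π ^ 2 / b) (π ^ 2 / a) (-z)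
      (x * z - y) (-x) n) : ℝ) : ℂ) :=
    Complex.ofRealCLM.summable hT
  apply Complex.ofReal_injective
  rw [Complex.ofReal_mul, Complex.ofReal_tsum, Complex.ofReal_tsum, tsum_triple hSC,
    tsum_triple hTC]
  have sw₁ : ∀ n₃ : ℤ, ∑' n₂ : ℤ, ∑' m₁ : ℤ, partialDual₁ a b c x y z n₃ n₂ m₁ =
      (√(π / b) : ℝ) * ∑' p : ℤ × ℤ, partialDual₂ a b c x y z n₃ p := by
    intro n₃
    -- Absolute summability allows the exchange that makes `n₂` innermost, ready for the next
    -- one-dimensional Poisson summation; `sw₂` does the same for `n₃`.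
    rw [(summable_partialDual₁ ha hb c x y z n₃).tsum_comm]
    have h := (summable_partialDual₂ ha hb hc x y z).prod_symm.prod_factor n₃
    simp only [Prod.swap, Function.uncurry] at h
    rw [h.tsum_prod]
    simp_rw [tsum_partialDual₁ hb, tsum_mul_left]
  have sw₂ : ∑' n₃ : ℤ, ∑' p : ℤ × ℤ, partialDual₂ a b c x y z n₃ p =
      (√(π / c) : ℝ) * ∑' m₁ : ℤ, ∑' m₂ : ℤ, ∑' m₃ : ℤ, ((Real.exp (-triForm (π ^ 2 / c)
        (π ^ 2 / b) (π ^ 2 / a) (-z) (x * z - y) (-x) ![m₃, m₂, m₁]) : ℝ) : ℂ) := by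
    have hs := summable_partialDual₂ ha hb hc x y z
    rw [hs.tsum_comm]
    have h := hs.prod
    simp only [Function.uncurry] at h
    rw [h.tsum_prod]
    simp_rw [tsum_partialDual₂ hc, tsum_mul_left]
  simp_rw [tsum_exp_neg_triForm_fst ha, tsum_mul_left, sw₁, tsum_mul_left]
  rw [sw₂]
  push_cast
  ring

/-! ### The second order remainder of `exp (-x)` -/

/-- The remainder `exp (-x) - 1 + x`. -/
def expRem (x : ℝ) : ℝ := Real.exp (-x) - 1 + x

theorem expRem_nonneg (x : ℝ) : 0 ≤ expRem x := by
  unfold expRem; linarith [Real.add_one_le_exp (-x)]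

theorem expRem_le (x : ℝ) : expRem x ≤ x ^ 2 * Real.exp |x| := by
  have h := Complex.norm_exp_sub_sum_le_norm_mul_exp ((-x : ℝ) : ℂ) 2
  have e : Complex.exp ((-x : ℝ) : ℂ) - ∑ m ∈ Finset.range 2, ((-x : ℝ) : ℂ) ^ m / (m.factorial : ℂ)
      = ((expRem x : ℝ) : ℂ) := by
    simp [Finset.sum_range_succ, expRem]
    ring
  rw [e, Complex.norm_real, Complex.norm_real, Real.norm_eq_abs, Real.norm_eq_abs, abs_neg,
    sq_abs] at h
  exact (le_abs_self _).trans h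

/-- The third order Taylor error is at most `(2/9)|x|³ ≤ (2/9)x²`, and `1/2 - 2/9 > 1/4`. -/
theorem le_expRem {x : ℝ} (hx : |x| ≤ 1) : x ^ 2 / 4 ≤ expRem x := by
  have h := Real.exp_bound (x := -x) (by rwa [abs_neg]) (n := 3) (by norm_num)
  simp only [Finset.sum_range_succ, Finset.sum_range_zero, Nat.factorial, abs_neg] at h
  have h1 := (abs_le.1 h).1
  have h2 : |x| ^ 3 ≤ x ^ 2 := by
    rw [pow_succ, sq_abs]; nlinarith [sq_nonneg x]
  unfold expRem
  norm_num at h1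
  nlinarith [sq_nonneg x]

/-! ### Quadratic forms on integer vectors -/

/-- The value of the quadratic form with matrix `S` at the integer vector `k`. -/
def qform (S : Matrix (Fin 3) (Fin 3) ℝ) (k : Fin 3 → ℤ) : ℝ :=
  ∑ i, ∑ j, S i j * (k i * k j)

/-- The squared Frobenius norm. -/
def frobSq (K : Matrix (Fin 3) (Fin 3) ℝ) : ℝ := ∑ i, ∑ j, K i j ^ 2

theorem frobSq_nonneg (K : Matrix (Fin 3) (Fin 3) ℝ) : 0 ≤ frobSq K := by
  unfold frobSq; positivity

theorem qform_one_add (K : Matrix (Fin 3) (Fin 3) ℝ) (k : Fin 3 → ℤ) :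
    qform (1 + K) k = normSq k + qform K k := by
  simp [qform, normSq, Fin.sum_univ_three, Matrix.one_apply]
  ring

theorem qform_one (k : Fin 3 → ℤ) : qform 1 k = normSq k := by
  simpa [qform] using qform_one_add 0 k

theorem qform_sq_le (K : Matrix (Fin 3) (Fin 3) ℝ) (k : Fin 3 → ℤ) :
    qform K k ^ 2 ≤ frobSq K * normSq k ^ 2 := by
  have h := Finset.sum_mul_sq_le_sq_mul_sq (Finset.univ : Finset (Fin 3 × Fin 3))
    (fun p => K p.1 p.2) (fun p => (k p.1 * k p.2 : ℝ))
  rw [Fintype.sum_prod_type, Fintype.sum_prod_type, Fintype.sum_prod_type] at h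
  refine h.trans (le_of_eq ?_)
  unfold frobSq
  congr 1
  simp only [Fin.sum_univ_three, normSq]
  ring

theorem abs_qform_le {K : Matrix (Fin 3) (Fin 3) ℝ} (hK : frobSq K ≤ 1 / 4) (k : Fin 3 → ℤ) :
    |qform K k| ≤ normSq k / 2 := by
  refine abs_le_of_sq_le_sq ?_ (by linarith [normSq_nonneg k])
  nlinarith [qform_sq_le K k, sq_nonneg (normSq k)]

theorem sq_apply_le_frobSq (K : Matrix (Fin 3) (Fin 3) ℝ) (i j : Fin 3) : K i j ^ 2 ≤ frobSq K :=
  (Finset.single_le_sum (f := fun j => K i j ^ 2) (fun _ _ => sq_nonneg _)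
    (Finset.mem_univ j)).trans (Finset.single_le_sum (f := fun i => ∑ j, K i j ^ 2)
      (fun _ _ => Finset.sum_nonneg fun _ _ => sq_nonneg _) (Finset.mem_univ i))

theorem abs_mul_le_half (p q : ℝ) : |p * q| ≤ (p ^ 2 + q ^ 2) / 2 := by
  rw [abs_mul]
  nlinarith [sq_nonneg (|p| - |q|), sq_abs p, sq_abs q]

theorem abs_mul_mul_le_half {r : ℝ} (p q : ℝ) (hr : |r| ≤ 1) :
    |p * q * r| ≤ (p ^ 2 + q ^ 2) / 2 := by
  rw [abs_mul]
  nlinarith [abs_mul_le_half p q, abs_nonneg (p * q)]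

/-- Expanding `det (1 + K) = 1` writes the trace as quadratic and cubic terms in the entries;
entries bounded by one let the cubic terms be estimated as quadratic ones. -/
theorem abs_trace_le {K : Matrix (Fin 3) (Fin 3) ℝ} (hK : frobSq K ≤ 1 / 4)
    (hdet : (1 + K).det = 1) : |K.trace| ≤ 4 * frobSq K := by
  have hle : ∀ i j, |K i j| ≤ 1 := fun i j => by
    rw [← sq_le_one_iff_abs_le_one]; linarith [sq_apply_le_frobSq K i j]
  rw [Matrix.det_fin_three] at hdet
  simp at hdet
  simp only [Matrix.trace, Matrix.diag, frobSq, Fin.sum_univ_three]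
  have a1 := abs_le.1 (abs_mul_le_half (K 0 0) (K 1 1))
  have a2 := abs_le.1 (abs_mul_le_half (K 0 0) (K 2 2))
  have a3 := abs_le.1 (abs_mul_le_half (K 1 1) (K 2 2))
  have a4 := abs_le.1 (abs_mul_le_half (K 0 1) (K 1 0))
  have a5 := abs_le.1 (abs_mul_le_half (K 0 2) (K 2 0))
  have a6 := abs_le.1 (abs_mul_le_half (K 1 2) (K 2 1))
  have b1 := abs_le.1 (abs_mul_mul_le_half (K 0 0) (K 1 1) (hle 2 2))
  have b2 := abs_le.1 (abs_mul_mul_le_half (K 1 2) (K 2 1) (hle 0 0))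
  have b3 := abs_le.1 (abs_mul_mul_le_half (K 0 1) (K 1 0) (hle 2 2))
  have b4 := abs_le.1 (abs_mul_mul_le_half (K 0 1) (K 1 2) (hle 2 0))
  have b5 := abs_le.1 (abs_mul_mul_le_half (K 0 2) (K 1 0) (hle 2 1))
  have b6 := abs_le.1 (abs_mul_mul_le_half (K 0 2) (K 2 0) (hle 1 1))
  have s : ∀ i j, 0 ≤ K i j ^ 2 := fun i j => sq_nonneg _
  have := s 0 0; have := s 0 1; have := s 0 2
  have := s 1 0; have := s 1 1; have := s 1 2
  have := s 2 0; have := s 2 1; have := s 2 2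
  rw [abs_le]
  constructor <;> nlinarith

/-! ### Cubic sets of integer vectors -/

/-- A set of integer vectors invariant under sign changes and permutations of coordinates. -/
structure IsCubic (Λ : Set (Fin 3 → ℤ)) : Prop where
  neg_mem : ∀ i k, Function.update k i (-k i) ∈ Λ ↔ k ∈ Λ
  perm_mem : ∀ (σ : Equiv.Perm (Fin 3)) k, k ∘ σ ∈ Λ ↔ k ∈ Λ

/-- The sign change of one coordinate. -/
def flipEquiv (i : Fin 3) : (Fin 3 → ℤ) ≃ (Fin 3 → ℤ) :=
  Function.Involutive.toPerm (fun k => Function.update k i (-k i)) fun k => by simp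

variable {Λ : Set (Fin 3 → ℤ)}

/-- The Gaussian energy of the vectors in `Λ` measured by the quadratic form `S`. -/
def cubicEnergy (Λ : Set (Fin 3 → ℤ)) (β : ℝ) (S : Matrix (Fin 3) (Fin 3) ℝ) : ℝ :=
  ∑' k : Λ, Real.exp (-β * qform S k)

/-- The Gaussian second moment of the first coordinate. -/
def cubicMoment (Λ : Set (Fin 3 → ℤ)) (β : ℝ) : ℝ :=
  ∑' k : Λ, (((k : Fin 3 → ℤ) 0 : ℝ)) ^ 2 * Real.exp (-β * normSq k)

theorem sq_apply_le_normSq (k : Fin 3 → ℤ) (i : Fin 3) : (k i : ℝ) ^ 2 ≤ normSq k := by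
  unfold normSq
  have h0 := sq_nonneg (k 0 : ℝ)
  have h1 := sq_nonneg (k 1 : ℝ)
  have h2 := sq_nonneg (k 2 : ℝ)
  fin_cases i <;> simp <;> linarith

theorem normSq_le_sq (k : Fin 3 → ℤ) : normSq k ≤ normSq k ^ 2 := by
  have : normSq k = ((k 0 ^ 2 + k 1 ^ 2 + k 2 ^ 2 : ℤ) : ℝ) := by simp [normSq]
  rw [this]
  exact_mod_cast Int.le_self_sq _

theorem summable_mul_mul_exp {β : ℝ} (hβ : 0 < β) (i j : Fin 3) :
    Summable fun k : Fin 3 → ℤ => (k i * k j : ℝ) * Real.exp (-β * normSq k) := by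
  refine Summable.of_norm_bounded (summable_normSq_sq_mul_exp hβ) fun k => ?_
  rw [norm_mul, Real.norm_eq_abs, Real.norm_of_nonneg (Real.exp_pos _).le]
  refine mul_le_mul_of_nonneg_right ?_ (Real.exp_pos _).le
  linarith [abs_mul_le_half (k i) (k j), sq_apply_le_normSq k i, sq_apply_le_normSq k j,
    normSq_le_sq k]

/-- Flipping the sign of coordinate `i` preserves `Λ` and negates each term. -/
theorem tsum_mul_mul_exp_of_ne (hΛ : IsCubic Λ) (β : ℝ) {i j : Fin 3} (hij : i ≠ j) :
    ∑' k : Λ, ((k : Fin 3 → ℤ) i * (k : Fin 3 → ℤ) j : ℝ) * Real.exp (-β * normSq k) = 0 := by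
  let e : Λ ≃ Λ := (flipEquiv i).subtypeEquiv fun k => (hΛ.neg_mem i k).symm
  have h := e.tsum_eq fun k : Λ =>
    ((k : Fin 3 → ℤ) i * (k : Fin 3 → ℤ) j : ℝ) * Real.exp (-β * normSq k)
  have h2 : ∀ k : Λ, (((e k : Fin 3 → ℤ)) i * ((e k : Fin 3 → ℤ)) j : ℝ) *
      Real.exp (-β * normSq (e k)) =
      -(((k : Fin 3 → ℤ) i * (k : Fin 3 → ℤ) j : ℝ) * Real.exp (-β * normSq k)) := by
    intro k
    have e1 : (e k : Fin 3 → ℤ) = Function.update (k : Fin 3 → ℤ) i (-(k : Fin 3 → ℤ) i) := rfl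
    have e2 : normSq (e k) = normSq k := by
      rw [e1, normSq, normSq]
      fin_cases i <;> simp
    rw [e2, e1, Function.update_self, Function.update_of_ne hij.symm]
    push_cast
    ring
  simp_rw [h2, tsum_neg] at h
  linarith

theorem tsum_sq_mul_exp (hΛ : IsCubic Λ) (β : ℝ) (i : Fin 3) :
    ∑' k : Λ, ((k : Fin 3 → ℤ) i * (k : Fin 3 → ℤ) i : ℝ) * Real.exp (-β * normSq k) =
      cubicMoment Λ β := by
  let e : Λ ≃ Λ := ((Equiv.swap 0 i).arrowCongr (Equiv.refl ℤ)).subtypeEquiv fun k =>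
    (hΛ.perm_mem (Equiv.swap 0 i) k).symm
  have h := e.tsum_eq fun k : Λ => ((k : Fin 3 → ℤ) 0 : ℝ) ^ 2 * Real.exp (-β * normSq k)
  rw [cubicMoment, ← h]
  refine tsum_congr fun k => ?_
  have e1 : (e k : Fin 3 → ℤ) = (k : Fin 3 → ℤ) ∘ Equiv.swap 0 i := rfl
  have e2 : normSq (e k) = normSq k := by
    rw [e1, normSq, normSq]
    fin_cases i
    · simp
    · simp [Equiv.swap_apply_of_ne_of_ne]; ring
    · simp [Equiv.swap_apply_of_ne_of_ne]; ring
  rw [e2, e1]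
  simp
  ring

/-- Cubic symmetry makes the second moment matrix scalar, so the first variation sees only the trace
of `K`. -/
theorem hasSum_qform_mul_exp (hΛ : IsCubic Λ) {β : ℝ} (hβ : 0 < β)
    (K : Matrix (Fin 3) (Fin 3) ℝ) :
    HasSum (fun k : Λ => qform K k * Real.exp (-β * normSq k)) (K.trace * cubicMoment Λ β) := by
  have h : ∀ i j, HasSum (fun k : Λ => K i j * (((k : Fin 3 → ℤ) i * (k : Fin 3 → ℤ) j : ℝ) *
      Real.exp (-β * normSq k))) (K i j * if i = j then cubicMoment Λ β else 0) := by
    intro i j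
    refine HasSum.mul_left _ ?_
    have hs := ((summable_mul_mul_exp hβ i j).subtype Λ).hasSum
    have e : (if i = j then cubicMoment Λ β else 0) =
        ∑' k : Λ, ((k : Fin 3 → ℤ) i * (k : Fin 3 → ℤ) j : ℝ) * Real.exp (-β * normSq k) := by
      split_ifs with hij
      · subst hij; exact (tsum_sq_mul_exp hΛ β i).symm
      · exact (tsum_mul_mul_exp_of_ne hΛ β hij).symm
    rw [e]
    exact hs
  have h2 := hasSum_sum (s := Finset.univ) fun i (_ : i ∈ Finset.univ) =>
    hasSum_sum (s := Finset.univ) fun j (_ : j ∈ Finset.univ) => h i j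
  convert h2 using 1
  · ext k
    simp only [qform, Finset.sum_mul]
    refine Finset.sum_congr rfl fun i _ => Finset.sum_congr rfl fun j _ => by ring
  · simp [Matrix.trace, Finset.sum_mul]

/-- The second order expansion of the energy at the identity. -/
theorem hasSum_expRem (hΛ : IsCubic Λ) {β : ℝ} (hβ : 0 < β) {K : Matrix (Fin 3) (Fin 3) ℝ}
    (hK : frobSq K ≤ 1 / 4) :
    HasSum (fun k : Λ => Real.exp (-β * normSq k) * expRem (β * qform K k))
      (cubicEnergy Λ β (1 + K) - cubicEnergy Λ β 1 + β * (K.trace * cubicMoment Λ β)) := by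
  have s1 : Summable fun k : Λ => Real.exp (-β * qform (1 + K) k) := by
    refine Summable.of_nonneg_of_le (fun k => (Real.exp_pos _).le) (fun k => ?_)
      ((summable_exp_neg_mul_normSq (half_pos hβ)).subtype Λ)
    simp only [Function.comp]
    rw [qform_one_add]
    refine Real.exp_le_exp.2 ?_
    nlinarith [(abs_le.1 (abs_qform_le hK k)).1]
  have s2 : Summable fun k : Λ => Real.exp (-β * qform 1 k) := by
    simp_rw [qform_one]
    exact (summable_exp_neg_mul_normSq hβ).subtype Λ
  have h := (s1.hasSum.sub s2.hasSum).add ((hasSum_qform_mul_exp hΛ hβ K).mul_left β)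
  refine h.congr_fun fun k => ?_
  have e : Real.exp (-β * qform (1 + K) k) =
      Real.exp (-β * normSq k) * Real.exp (-(β * qform K k)) := by
    rw [← Real.exp_add, qform_one_add]; congr 1; ring
  rw [e, qform_one, expRem]
  ring

/-- Both the remainder and, thanks to the determinant, the trace term are quadratic in `K`. This is
what makes cubic lattices critical at every `β`. -/
theorem exists_abs_cubicEnergy_sub_le (hΛ : IsCubic Λ) {β : ℝ} (hβ : 0 < β) :
    ∃ C, ∀ K : Matrix (Fin 3) (Fin 3) ℝ, frobSq K ≤ 1 / 4 → (1 + K).det = 1 →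
      |cubicEnergy Λ β (1 + K) - cubicEnergy Λ β 1| ≤ C * frobSq K := by
  have hs := (summable_normSq_sq_mul_exp (half_pos hβ)).subtype Λ
  set D : ℝ := ∑' k : Λ, normSq k ^ 2 * Real.exp (-(β / 2) * normSq k) with hD
  refine ⟨β ^ 2 * D + β * (4 * |cubicMoment Λ β|), fun K hK hdet => ?_⟩
  have h := hasSum_expRem hΛ hβ hK
  have h0 := h.nonneg fun k => mul_nonneg (Real.exp_pos _).le (expRem_nonneg _)
  have h1 := hasSum_le (fun k : Λ => (?_ : Real.exp (-β * normSq k) * expRem (β * qform K k) ≤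
    (frobSq K * β ^ 2) * (normSq k ^ 2 * Real.exp (-(β / 2) * normSq k)))) h
    (hs.hasSum.mul_left (frobSq K * β ^ 2))
  · have h2 : |β * (K.trace * cubicMoment Λ β)| ≤
        β * (4 * |cubicMoment Λ β|) * frobSq K := by
      rw [abs_mul, abs_mul, abs_of_pos hβ]
      nlinarith [mul_le_mul_of_nonneg_right (abs_trace_le hK hdet)
        (mul_nonneg hβ.le (abs_nonneg (cubicMoment Λ β)))]
    change _ ≤ frobSq K * β ^ 2 * D at h1
    rw [abs_le] at h2 ⊢
    have h3 : 0 ≤ frobSq K * β ^ 2 * D := h0.trans h1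
    constructor <;> nlinarith [h2.1, h2.2]
  · have e := expRem_le (β * qform K k)
    have e1 : |β * qform K k| ≤ β * (normSq k / 2) := by
      rw [abs_mul, abs_of_pos hβ]
      exact mul_le_mul_of_nonneg_left (abs_qform_le hK k) hβ.le
    calc Real.exp (-β * normSq k) * expRem (β * qform K k)
        ≤ Real.exp (-β * normSq k) * ((β * qform K k) ^ 2 * Real.exp (β * (normSq k / 2))) := by
          gcongr
          exact e.trans (mul_le_mul_of_nonneg_left (Real.exp_le_exp.2 e1) (sq_nonneg _))
      _ = β ^ 2 * qform K k ^ 2 * Real.exp (-(β / 2) * normSq k) := by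
          have : Real.exp (-(β / 2) * normSq k) =
              Real.exp (-β * normSq k) * Real.exp (β * (normSq k / 2)) := by
            rw [← Real.exp_add]; congr 1; ring
          rw [this]; ring
      _ ≤ β ^ 2 * (frobSq K * normSq k ^ 2) * Real.exp (-(β / 2) * normSq k) := by
          gcongr
          exact qform_sq_le K k
      _ = _ := by ring

theorem cubicMoment_nonneg (β : ℝ) : 0 ≤ cubicMoment Λ β := by
  unfold cubicMoment
  positivity

theorem summable_cubicMoment {β : ℝ} (hβ : 0 < β) :
    Summable fun k : Λ => ((k : Fin 3 → ℤ) 0 : ℝ) ^ 2 * Real.exp (-β * normSq k) :=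
  ((summable_mul_mul_exp hβ 0 0).subtype Λ).congr fun k => by simp [sq]

/-- Comparison with `β = 1`, giving away `exp (-(β - 1) m)`. With `C` independent of `β`, the trace
term has the exponential order of the first shell. -/
theorem exists_cubicMoment_le (Λ : Set (Fin 3 → ℤ)) {m : ℝ} (hm : ∀ k ∈ Λ, m ≤ normSq k) :
    ∃ C, ∀ β, 1 ≤ β → cubicMoment Λ β ≤ C * Real.exp (-β * m) := by
  refine ⟨Real.exp m * cubicMoment Λ 1, fun β hβ => ?_⟩
  have h := Summable.tsum_le_tsum (fun k : Λ => (?_ :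
    ((k : Fin 3 → ℤ) 0 : ℝ) ^ 2 * Real.exp (-β * normSq k) ≤
    Real.exp (-(β - 1) * m) * (((k : Fin 3 → ℤ) 0 : ℝ) ^ 2 * Real.exp (-1 * normSq k))))
    (summable_cubicMoment (by linarith)) ((summable_cubicMoment one_pos).mul_left _)
  · rw [tsum_mul_left] at h
    refine h.trans (le_of_eq ?_)
    have : Real.exp (-(β - 1) * m) = Real.exp m * Real.exp (-β * m) := by
      rw [← Real.exp_add]; congr 1; ring
    rw [this, cubicMoment]
    ring
  · rw [mul_left_comm, ← Real.exp_add]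
    gcongr
    nlinarith [hm k k.2]

/-! ### The face-centred cubic model -/

/-- The nonzero integer vectors with even coordinate sum. -/
def fccSet : Set (Fin 3 → ℤ) := {k | Even (k 0 + k 1 + k 2) ∧ k ≠ 0}

theorem isCubic_setOf_ne_zero {P : (Fin 3 → ℤ) → Prop}
    (h1 : ∀ i k, P k → P (Function.update k i (-k i)))
    (h2 : ∀ (σ : Equiv.Perm (Fin 3)) k, P k → P (k ∘ σ)) : IsCubic {k | P k ∧ k ≠ 0} where
  neg_mem i k := by
    have key : ∀ k, (P k ∧ k ≠ 0) → (P (Function.update k i (-k i)) ∧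
        Function.update k i (-k i) ≠ 0) := fun k hk => ⟨h1 i k hk.1, fun h => hk.2 (by
      ext j
      have hj := congrFun h j
      by_cases hji : j = i
      · subst hji; simpa using hj
      · simpa [Function.update_of_ne hji] using hj)⟩
    exact ⟨fun h => by simpa using key _ h, key k⟩
  perm_mem σ k := by
    have key : ∀ (σ : Equiv.Perm (Fin 3)) k, (P k ∧ k ≠ 0) → (P (k ∘ σ) ∧ k ∘ σ ≠ 0) :=
      fun σ k hk => ⟨h2 σ k hk.1, fun h => hk.2 (by
        ext j
        simpa using congrFun h (σ.symm j))⟩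
    refine ⟨fun h => ?_, key σ k⟩
    have := key σ.symm _ h
    simpa [Function.comp_assoc] using this

theorem isCubic_fccSet : IsCubic fccSet := by
  refine isCubic_setOf_ne_zero (fun i k h => ?_) (fun σ k h => ?_)
  · fin_cases i <;> simp [Int.even_add, Function.update] at h ⊢ <;> exact h
  · have e : (k ∘ σ) 0 + (k ∘ σ) 1 + (k ∘ σ) 2 = k 0 + k 1 + k 2 := by
      have := Equiv.sum_comp σ k
      simpa [Fin.sum_univ_three] using this
    rwa [e]

theorem two_le_normSq_of_mem_fccSet {k : Fin 3 → ℤ} (hk : k ∈ fccSet) : 2 ≤ normSq k := by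
  have e : normSq k = ((k 0 ^ 2 + k 1 ^ 2 + k 2 ^ 2 : ℤ) : ℝ) := by simp [normSq]
  rw [e]
  obtain ⟨h, h0⟩ := hk
  have hev : Even (k 0 ^ 2 + k 1 ^ 2 + k 2 ^ 2) := by
    simpa [Int.even_add, Int.even_pow] using h
  have hpos : 0 < k 0 ^ 2 + k 1 ^ 2 + k 2 ^ 2 := by
    by_contra! hle
    apply h0
    ext i
    have : k i ^ 2 = 0 := by
      have a0 := sq_nonneg (k 0)
      have a1 := sq_nonneg (k 1)
      have a2 := sq_nonneg (k 2)
      fin_cases i <;> simp only [Fin.zero_eta, Fin.mk_one, Fin.reduceFinMk] <;> omega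
    simpa using this
  obtain ⟨r, hr⟩ := hev
  have : 2 ≤ k 0 ^ 2 + k 1 ^ 2 + k 2 ^ 2 := by omega
  exact_mod_cast this

/-- The shortest vectors of the face-centred cubic model, up to sign. -/
def fccShell : Fin 6 → fccSet :=
  ![⟨![1, 1, 0], by decide, by decide⟩, ⟨![1, -1, 0], by decide, by decide⟩,
    ⟨![1, 0, 1], by decide, by decide⟩, ⟨![1, 0, -1], by decide, by decide⟩,
    ⟨![0, 1, 1], by decide, by decide⟩, ⟨![0, 1, -1], by decide, by decide⟩]

theorem fccShell_injective : Function.Injective fccShell := by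
  have h : Function.Injective fun i => (fccShell i : Fin 3 → ℤ) := by decide
  exact fun i j hij => h (congrArg Subtype.val hij)

theorem normSq_fccShell (i : Fin 6) : normSq (fccShell i) = 2 := by
  fin_cases i <;> simp [fccShell, normSq] <;> norm_num

/-- The right side equals `2 ∑ Kᵢᵢ² + 2 (tr K)² + 8 ∑_{i<j} Kᵢⱼ²`: the FCC shell detects every
symmetric `K`. -/
theorem frobSq_le_sum_fccShell {K : Matrix (Fin 3) (Fin 3) ℝ} (hK : K.IsSymm) :
    2 * frobSq K ≤ ∑ i, qform K (fccShell i) ^ 2 := by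
  have h1 : K 1 0 = K 0 1 := hK.apply 0 1
  have h2 : K 2 0 = K 0 2 := hK.apply 0 2
  have h3 : K 2 1 = K 1 2 := hK.apply 1 2
  simp [Fin.sum_univ_succ, fccShell, qform, frobSq, h1, h2, h3]
  nlinarith [sq_nonneg (K 0 0 + K 1 1 + K 2 2), sq_nonneg (K 0 1), sq_nonneg (K 0 2),
    sq_nonneg (K 1 2)]

/-- The first shell alone contributes at least `(β²/2) e^{-2β} frobSq K`, while the trace term is at
most `4Cβ e^{-2β} frobSq K`; hence the threshold `8C`. -/
theorem exists_fcc_energy_le : ∃ β₁ > 0, ∀ β > β₁, ∃ ε > 0, ∀ K : Matrix (Fin 3) (Fin 3) ℝ,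
    K.IsSymm → (1 + K).det = 1 → frobSq K ≤ ε →
      cubicEnergy fccSet β 1 ≤ cubicEnergy fccSet β (1 + K) := by
  obtain ⟨C, hC⟩ := exists_cubicMoment_le fccSet (m := 2) fun k => two_le_normSq_of_mem_fccSet
  refine ⟨max 1 (8 * C), by positivity, fun β hβ => ?_⟩
  have hβ1 : 1 < β := (le_max_left _ _).trans_lt hβ
  have hβC : 8 * C < β := (le_max_right _ _).trans_lt hβ
  have hβ0 : 0 < β := by linarith
  -- With this radius `|β * qform K k| ≤ 1` on the shell, as `le_expRem` requires.
  refine ⟨1 / (4 * β ^ 2), by positivity, fun K hsym hdet hKε => ?_⟩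
  have hK : frobSq K ≤ 1 / 4 := hKε.trans (by
    rw [div_le_div_iff₀ (by positivity) (by norm_num)]; nlinarith)
  have h := hasSum_expRem isCubic_fccSet hβ0 hK
  have h1 := tsum_comp_le_tsum_of_inj h.summable
    (fun k => mul_nonneg (Real.exp_pos _).le (expRem_nonneg _)) fccShell_injective
  rw [h.tsum_eq, tsum_fintype] at h1
  have h2 : ∀ i, Real.exp (-β * 2) * (β ^ 2 * qform K (fccShell i) ^ 2 / 4) ≤
      Real.exp (-β * normSq (fccShell i)) * expRem (β * qform K (fccShell i)) := by
    intro i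
    rw [normSq_fccShell]
    refine mul_le_mul_of_nonneg_left ?_ (Real.exp_pos _).le
    rw [← mul_pow]
    refine le_expRem ?_
    rw [← sq_le_one_iff_abs_le_one, mul_pow]
    have := qform_sq_le K (fccShell i)
    rw [normSq_fccShell] at this
    rw [le_div_iff₀ (by positivity)] at hKε
    nlinarith [sq_nonneg β]
  have h3 := (Finset.sum_le_sum fun i _ => h2 i).trans h1
  rw [← Finset.mul_sum, ← Finset.sum_div, ← Finset.mul_sum] at h3
  have h4 : Real.exp (-β * 2) * (β ^ 2 * (2 * frobSq K) / 4) ≤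
      Real.exp (-β * 2) * (β ^ 2 * (∑ i, qform K (fccShell i) ^ 2) / 4) := by
    gcongr
    exact frobSq_le_sum_fccShell hsym
  have h5 := (abs_le.1 (abs_trace_le hK hdet)).2
  have h6 := hC β hβ1.le
  have h7 : β * (K.trace * cubicMoment fccSet β) ≤
      β * (4 * frobSq K * (C * Real.exp (-β * 2))) := by
    have := frobSq_nonneg K
    have := cubicMoment_nonneg (Λ := fccSet) β
    gcongr
  have h8 : 0 ≤ Real.exp (-β * 2) * frobSq K * β * (β - 8 * C) := by
    have := frobSq_nonneg K
    have : 0 ≤ β - 8 * C := by linarith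
    positivity
  nlinarith

/-! ### The body-centred cubic model -/

/-- The nonzero integer vectors whose coordinates all have the same parity. -/
def bccSet : Set (Fin 3 → ℤ) := {k | (∀ i j, Even (k i + k j)) ∧ k ≠ 0}

theorem isCubic_bccSet : IsCubic bccSet := by
  refine isCubic_setOf_ne_zero (fun i k h a b => ?_) (fun σ k h a b => h (σ a) (σ b))
  have e : ∀ j, Even (Function.update k i (-k i) j) ↔ Even (k j) := by
    intro j
    by_cases hj : j = i
    · subst hj; simp
    · simp [Function.update_of_ne hj]
  rw [Int.even_add, e, e, ← Int.even_add]
  exact h a b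

/-- If all coordinates have modulus at most one, equal parity and `k ≠ 0` force each to be `±1`;
otherwise one square is already at least `4`. -/
theorem bccSet_dichotomy {k : Fin 3 → ℤ} (hk : k ∈ bccSet) :
    (∀ i, (k i : ℝ) ^ 2 = 1) ∨ 4 ≤ normSq k := by
  have e : normSq k = ((k 0 ^ 2 + k 1 ^ 2 + k 2 ^ 2 : ℤ) : ℝ) := by simp [normSq]
  obtain ⟨h, h0⟩ := hk
  have big : ∀ i, 4 ≤ k i ^ 2 → 4 ≤ normSq k := fun i hi => by
    have : (4 : ℝ) ≤ (k i : ℝ) ^ 2 := by exact_mod_cast hi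
    exact this.trans (sq_apply_le_normSq k i)
  have four : ∀ i, k i ≠ 0 → k i ≠ 1 → k i ≠ -1 → 4 ≤ k i ^ 2 := by
    intro i a b c
    rcases (by omega : 2 ≤ k i ∨ k i ≤ -2) with h | h <;> nlinarith
  by_cases hall : ∀ i, k i = 1 ∨ k i = -1
  · left
    intro i
    rcases hall i with h | h <;> simp [h]
  · right
    push Not at hall
    obtain ⟨i, hi1, hi2⟩ := hall
    by_cases hi0 : k i = 0
    · obtain ⟨j, hj⟩ : ∃ j, k j ≠ 0 := by
        by_contra! hc
        exact h0 (funext hc)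
      have hev := h i j
      rw [hi0, zero_add] at hev
      refine big j (four j hj ?_ ?_) <;> rintro hj <;> rw [hj] at hev <;> revert hev <;> decide
    · exact big i (four i hi0 hi1 hi2)

theorem three_le_normSq_of_mem_bccSet {k : Fin 3 → ℤ} (hk : k ∈ bccSet) : 3 ≤ normSq k := by
  rcases bccSet_dichotomy hk with h | h
  · rw [normSq, h, h, h]; norm_num
  · linarith

/-- The vector `(1, 1, 1)`. -/
def bccDiag : bccSet := ⟨![1, 1, 1], by decide, by decide⟩

theorem normSq_bccDiag : normSq bccDiag = 3 := by
  simp [bccDiag, normSq]; norm_num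

/-- A shear direction, normalized so that `1 + shearDir t` has determinant one. -/
def shearDir (t : ℝ) : Matrix (Fin 3) (Fin 3) ℝ := !![0, t, 0; t, t ^ 2, 0; 0, 0, 0]

theorem det_one_add_shearDir (t : ℝ) : (1 + shearDir t).det = 1 := by
  simp [Matrix.det_fin_three, shearDir]
  ring

theorem isSymm_shearDir (t : ℝ) : (shearDir t).IsSymm := by
  ext i j
  fin_cases i <;> fin_cases j <;> simp [shearDir]

theorem tendsto_one_add_shearDir : Tendsto (fun t => 1 + shearDir t) (𝓝[>] 0) (𝓝 1) := by
  have h : Continuous fun t => 1 + shearDir t := by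
    refine continuous_matrix fun i j => ?_
    fin_cases i <;> fin_cases j <;> simp [shearDir] <;> fun_prop
  have h0 : 1 + shearDir 0 = 1 := by
    ext i j
    fin_cases i <;> fin_cases j <;> simp [shearDir]
  have := h.tendsto 0
  rw [h0] at this
  exact this.mono_left nhdsWithin_le_nhds

/-- A diagonal direction, normalized so that `1 + diagDir t` has determinant one. -/
def diagDir (t : ℝ) : Matrix (Fin 3) (Fin 3) ℝ := !![t, 0, 0; 0, -(t / (1 + t)), 0; 0, 0, 0]

theorem det_one_add_diagDir {t : ℝ} (ht : 0 < t) : (1 + diagDir t).det = 1 := by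
  simp [Matrix.det_fin_three, diagDir]
  field_simp
  ring

theorem isSymm_diagDir (t : ℝ) : (diagDir t).IsSymm := by
  ext i j
  fin_cases i <;> fin_cases j <;> simp [diagDir]

theorem tendsto_one_add_diagDir : Tendsto (fun t => 1 + diagDir t) (𝓝[>] 0) (𝓝 1) := by
  have h : ContinuousAt (fun t => 1 + diagDir t) 0 := by
    have hd : ContinuousAt (fun t : ℝ => t / (1 + t)) 0 :=
      continuousAt_id.div (by fun_prop) (by norm_num)
    refine continuousAt_pi.2 fun i => continuousAt_pi.2 fun j => ?_
    fin_cases i <;> fin_cases j <;> simp [diagDir] <;> fun_prop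
  have h0 : 1 + diagDir 0 = 1 := by
    ext i j
    fin_cases i <;> fin_cases j <;> simp [diagDir]
  have := h.tendsto
  rw [h0] at this
  exact this.mono_left nhdsWithin_le_nhds

/-- The shear takes the value `2t + t²` at `(1, 1, 1)`, of first order in `t`. That one vector
contributes at least `β² t² e^{-3β}`, against a trace term of at most `C β t² e^{-3β}`. -/
theorem exists_bcc_energy_lt_shear : ∃ β₁ > 0, ∀ β > β₁, ∀ᶠ t in 𝓝[>] (0 : ℝ),
    cubicEnergy bccSet β 1 < cubicEnergy bccSet β (1 + shearDir t) := by
  obtain ⟨C, hC⟩ := exists_cubicMoment_le bccSet (m := 3) fun k => three_le_normSq_of_mem_bccSet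
  refine ⟨max 1 C, by positivity, fun β hβ => ?_⟩
  have hβ1 : 1 < β := (le_max_left _ _).trans_lt hβ
  have hβC : C < β := (le_max_right _ _).trans_lt hβ
  have hβ0 : 0 < β := by linarith
  have hlt : (0 : ℝ) < 1 / (4 * β) := by positivity
  filter_upwards [Ioo_mem_nhdsGT hlt] with t ht
  obtain ⟨ht0, ht1⟩ := ht
  have ht2 : 4 * β * t < 1 := by rwa [lt_div_iff₀ (by positivity), mul_comm] at ht1
  have ht3 : t < 1 / 4 := by nlinarith
  have hK : frobSq (shearDir t) ≤ 1 / 4 := by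
    simp [frobSq, Fin.sum_univ_three, shearDir]
    nlinarith [pow_le_pow_left₀ ht0.le ht3.le 2, pow_le_pow_left₀ ht0.le ht3.le 4]
  have h := hasSum_expRem isCubic_bccSet hβ0 hK
  have h1 := le_hasSum h bccDiag fun k _ => mul_nonneg (Real.exp_pos _).le (expRem_nonneg _)
  have hq : qform (shearDir t) bccDiag = 2 * t + t ^ 2 := by
    simp [qform, Fin.sum_univ_three, shearDir, bccDiag]; ring
  have htr : (shearDir t).trace = t ^ 2 := by
    simp [Matrix.trace, Fin.sum_univ_three, shearDir]
  rw [normSq_bccDiag, hq, htr] at h1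
  have h2 : (β * (2 * t + t ^ 2)) ^ 2 / 4 ≤ expRem (β * (2 * t + t ^ 2)) := by
    refine le_expRem ?_
    rw [abs_of_pos (by positivity)]
    nlinarith
  have h3 : β ^ 2 * t ^ 2 ≤ (β * (2 * t + t ^ 2)) ^ 2 / 4 := by
    have : (β * (2 * t)) ^ 2 ≤ (β * (2 * t + t ^ 2)) ^ 2 := by
      gcongr
      nlinarith [sq_nonneg t]
    nlinarith
  have h4 := mul_le_mul_of_nonneg_left (h3.trans h2) (Real.exp_pos (-β * 3)).le
  have h5 := mul_le_mul_of_nonneg_left (hC β hβ1.le) (by positivity : 0 ≤ β * t ^ 2)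
  have h6 : 0 < β * t ^ 2 * Real.exp (-β * 3) * (β - C) := by
    have : 0 < β - C := by linarith
    positivity
  nlinarith

theorem abs_qform_diagDir_le {t : ℝ} (ht : 0 < t) (k : Fin 3 → ℤ) :
    |qform (diagDir t) k| ≤ t * normSq k := by
  have e : qform (diagDir t) k = t * (k 0 : ℝ) ^ 2 - t / (1 + t) * (k 1 : ℝ) ^ 2 := by
    simp [qform, Fin.sum_univ_three, diagDir]; ring
  have h1 : t / (1 + t) ≤ t := div_le_self ht.le (by linarith)
  have h0 : 0 ≤ t / (1 + t) := by positivity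
  have h2 := mul_le_mul_of_nonneg_right h1 (sq_nonneg (k 1 : ℝ))
  have h3 := mul_nonneg h0 (sq_nonneg (k 1 : ℝ))
  have h4 := mul_nonneg ht.le (sq_nonneg (k 0 : ℝ))
  have h5 := mul_nonneg ht.le (sq_nonneg (k 2 : ℝ))
  rw [e, normSq, abs_le]
  constructor <;> nlinarith

/-- Apart from `e^{-3β}` the bound is free of `β`. On the first shell the form is only `t²/(1+t)`;
on longer vectors the gap between squared lengths `3` and `4` leaves enough decay to absorb the
factor `β²`. -/
theorem exp_mul_expRem_diagDir_le {β t : ℝ} (hβ : 1 < β) (ht : 0 < t) (ht' : β * t < 1 / 8)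
    {k : Fin 3 → ℤ} (hk : k ∈ bccSet) :
    Real.exp (-β * normSq k) * expRem (β * qform (diagDir t) k) ≤
      512 * t ^ 2 * Real.exp (-β * 3) * Real.exp (-(1 / 16) * normSq k) := by
  have hβ0 : 0 < β := by linarith
  have htb : t < 1 / 8 := by nlinarith
  rcases bccSet_dichotomy hk with h | h
  · have hn : normSq k = 3 := by rw [normSq, h, h, h]; norm_num
    have hq : qform (diagDir t) k = t ^ 2 / (1 + t) := by
      have e : qform (diagDir t) k = t * (k 0 : ℝ) ^ 2 - t / (1 + t) * (k 1 : ℝ) ^ 2 := by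
        simp [qform, Fin.sum_univ_three, diagDir]; ring
      rw [e, h, h]
      field_simp
      ring
    have hq0 : 0 ≤ t ^ 2 / (1 + t) := by positivity
    have hq1 : t ^ 2 / (1 + t) ≤ t ^ 2 := div_le_self (sq_nonneg t) (by linarith)
    have hx : β * (t ^ 2 / (1 + t)) ≤ t := by
      calc β * (t ^ 2 / (1 + t)) ≤ β * t ^ 2 := by gcongr
        _ = β * t * t := by ring
        _ ≤ 1 * t := by gcongr; linarith
        _ = t := one_mul t
    have hx0 : 0 ≤ β * (t ^ 2 / (1 + t)) := by positivity
    rw [hn, hq]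
    have h1 : expRem (β * (t ^ 2 / (1 + t))) ≤ t ^ 2 * Real.exp 1 := by
      refine (expRem_le _).trans ?_
      rw [abs_of_nonneg hx0]
      gcongr
      linarith
    have h2 : Real.exp 1 ≤ 512 * Real.exp (-(1 / 16) * 3) := by
      have a := Real.exp_one_lt_d9
      have b := Real.add_one_le_exp (-(1 / 16) * 3 : ℝ)
      norm_num at a b ⊢
      linarith
    calc Real.exp (-β * 3) * expRem (β * (t ^ 2 / (1 + t)))
        ≤ Real.exp (-β * 3) * (t ^ 2 * (512 * Real.exp (-(1 / 16) * 3))) := by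
          gcongr
          exact h1.trans (by gcongr)
      _ = _ := by ring
  · have hn := normSq_nonneg k
    have hq := abs_qform_diagDir_le ht k
    have hx : |β * qform (diagDir t) k| ≤ β * (t * normSq k) := by
      rw [abs_mul, abs_of_pos hβ0]; gcongr
    have h1 : expRem (β * qform (diagDir t) k) ≤
        (β * (t * normSq k)) ^ 2 * Real.exp (β * (1 / 8 * normSq k)) := by
      refine (expRem_le _).trans ?_
      rw [← sq_abs]
      gcongr
      exact hx.trans (by gcongr)
    -- The scale `16` produces `16² = 256`, which with the bound `2` gives the constant `512`.
    have h2 := sq_mul_exp_neg_le (y := β * normSq k / 16) (by positivity)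
    -- With `n = normSq k` and `β > 1`, `(7/8)βn - βn/16 - n/16 ≥ (3/4)βn ≥ 3β`, because `n ≥ 4`.
    have h3 : Real.exp (-β * normSq k) * Real.exp (β * (1 / 8 * normSq k)) ≤
        Real.exp (-β * 3) * Real.exp (-(β * normSq k / 16)) *
          Real.exp (-(1 / 16) * normSq k) := by
      rw [← Real.exp_add, ← Real.exp_add, ← Real.exp_add]
      refine Real.exp_le_exp.2 ?_
      nlinarith
    calc Real.exp (-β * normSq k) * expRem (β * qform (diagDir t) k)
        ≤ Real.exp (-β * normSq k) *
          ((β * (t * normSq k)) ^ 2 * Real.exp (β * (1 / 8 * normSq k))) := by gcongr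
      _ = (β * (t * normSq k)) ^ 2 *
          (Real.exp (-β * normSq k) * Real.exp (β * (1 / 8 * normSq k))) := by ring
      _ ≤ (β * (t * normSq k)) ^ 2 * (Real.exp (-β * 3) * Real.exp (-(β * normSq k / 16)) *
          Real.exp (-(1 / 16) * normSq k)) := by gcongr
      _ = 256 * t ^ 2 * Real.exp (-β * 3) * Real.exp (-(1 / 16) * normSq k) *
          ((β * normSq k / 16) ^ 2 * Real.exp (-(β * normSq k / 16))) := by ring
      _ ≤ 256 * t ^ 2 * Real.exp (-β * 3) * Real.exp (-(1 / 16) * normSq k) * 2 := by gcongr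
      _ = _ := by ring

/-- The trace is at least `t²/2` and the moment at least `e^{-3β}`, so the trace term gains `(β/2)
t² e^{-3β}` over remainders of at most `512 D t² e^{-3β}`. -/
theorem exists_bcc_energy_diag_lt : ∃ β₁ > 0, ∀ β > β₁, ∀ᶠ t in 𝓝[>] (0 : ℝ),
    cubicEnergy bccSet β (1 + diagDir t) < cubicEnergy bccSet β 1 := by
  have hs := (summable_exp_neg_mul_normSq (c := 1 / 16) (by norm_num)).subtype bccSet
  set D : ℝ := ∑' k : bccSet, Real.exp (-(1 / 16) * normSq k) with hD
  have hD0 : 0 ≤ D := tsum_nonneg fun k => (Real.exp_pos _).le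
  refine ⟨max 1 (1024 * D), by positivity, fun β hβ => ?_⟩
  have hβ1 : 1 < β := (le_max_left _ _).trans_lt hβ
  have hβD : 1024 * D < β := (le_max_right _ _).trans_lt hβ
  have hβ0 : 0 < β := by linarith
  have hlt : (0 : ℝ) < 1 / (8 * β) := by positivity
  filter_upwards [Ioo_mem_nhdsGT hlt] with t ht
  obtain ⟨ht0, ht1⟩ := ht
  have ht2 : β * t < 1 / 8 := by
    rw [lt_div_iff₀ (by positivity)] at ht1; linarith
  have ht3 : t < 1 / 8 := by nlinarith
  have hK : frobSq (diagDir t) ≤ 1 / 4 := by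
    have h1 : t / (1 + t) ≤ t := div_le_self ht0.le (by linarith)
    have h0 : 0 ≤ t / (1 + t) := by positivity
    simp [frobSq, Fin.sum_univ_three, diagDir]
    nlinarith
  have h := hasSum_expRem isCubic_bccSet hβ0 hK
  have h1 := hasSum_le (fun k : bccSet => exp_mul_expRem_diagDir_le hβ1 ht0 ht2 k.2) h
    (hs.hasSum.mul_left _)
  change _ ≤ 512 * t ^ 2 * Real.exp (-β * 3) * D at h1
  have htr : (diagDir t).trace = t ^ 2 / (1 + t) := by
    simp [Matrix.trace, Fin.sum_univ_three, diagDir]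
    field_simp
    ring
  have hm : Real.exp (-β * 3) ≤ cubicMoment bccSet β := by
    have := (summable_cubicMoment (Λ := bccSet) hβ0).le_tsum bccDiag fun k _ => by positivity
    rw [normSq_bccDiag] at this
    simpa [bccDiag, cubicMoment] using this
  have h2 : t ^ 2 / 2 ≤ t ^ 2 / (1 + t) := by gcongr; linarith
  have h3 : β * (t ^ 2 / 2 * Real.exp (-β * 3)) ≤
      β * ((diagDir t).trace * cubicMoment bccSet β) := by
    rw [htr]; gcongr
  have h4 : 0 < t ^ 2 * Real.exp (-β * 3) * (β - 1024 * D) := by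
    have : 0 < β - 1024 * D := by linarith
    positivity
  nlinarith

/-! ### Gram matrices and energies -/

/-- The energy of the lattice with Gram matrix `A`. -/
def gramEnergy (α : ℝ) (A : Matrix (Fin 3) (Fin 3) ℝ) : ℝ :=
  ∑' n : {n : Fin 3 → ℤ // n ≠ 0}, Real.exp (-α * qform A n)

/-- The Gram matrix of the basis attached to the parameters `q`, at volume one. -/
def gramMat (q : Fin 5 → ℝ) : Matrix (Fin 3) (Fin 3) ℝ :=
  !![latConst 1 / q 0, latConst 1 * q 2 / q 0, latConst 1 * q 3 / q 0;
    latConst 1 * q 2 / q 0, latConst 1 * (q 2 ^ 2 + q 1 ^ 2) / q 0,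
      latConst 1 * (q 2 * q 3 + q 1 ^ 2 * q 4) / q 0;
    latConst 1 * q 3 / q 0, latConst 1 * (q 2 * q 3 + q 1 ^ 2 * q 4) / q 0,
      latConst 1 * ((q 3 ^ 2 + q 1 ^ 2 * q 4 ^ 2) / q 0 + q 0 ^ 2 / (2 * q 1 ^ 2))]

theorem latConst_one_pos : 0 < latConst 1 := by
  unfold latConst; positivity

theorem latConst_one_pow : latConst 1 ^ 3 = 2 := by
  unfold latConst
  rw [Real.one_rpow, one_mul, ← Real.rpow_natCast, ← Real.rpow_mul (by norm_num)]
  norm_num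

theorem sqrt_two_eq : √2 = √(latConst 1) ^ 3 := by
  have h := Real.sq_sqrt latConst_one_pos.le
  rw [← Real.sqrt_sq (by positivity : 0 ≤ √(latConst 1) ^ 3)]
  congr 1
  rw [← latConst_one_pow, pow_right_comm, h]

theorem inner_basisVec {q : Fin 5 → ℝ} (hq : q ∈ paramDomain) (i j : Fin 3) :
    inner ℝ (basisVec 1 q i) (basisVec 1 q j) = gramMat q i j := by
  obtain ⟨hu, hv⟩ := hq
  obtain ⟨c, hc, hC, hC'⟩ : ∃ c > 0, √(latConst 1) = c ∧ latConst 1 = c ^ 2 :=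
    ⟨_, Real.sqrt_pos.2 latConst_one_pos, rfl, (Real.sq_sqrt latConst_one_pos.le).symm⟩
  obtain ⟨s, hs, hsu, hsu'⟩ : ∃ s > 0, √(q 0) = s ∧ q 0 = s ^ 2 :=
    ⟨_, Real.sqrt_pos.2 hu, rfl, (Real.sq_sqrt hu.le).symm⟩
  obtain ⟨t, h20, ht, h2⟩ : ∃ t > 0, √2 = t ∧ t ^ 2 = 2 :=
    ⟨_, Real.sqrt_pos.2 zero_lt_two, rfl, Real.sq_sqrt zero_le_two⟩
  rw [PiLp.inner_apply, Fin.sum_univ_three]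
  simp only [RCLike.inner_apply, conj_trivial]
  fin_cases i <;> fin_cases j <;> simp [basisVec, gramMat, hC, hsu, ht] <;>
    (try simp only [hC', hsu']) <;> (try field_simp) <;> (try simp only [h2]) <;> (try ring)

theorem linearIndependent_basisVec {q : Fin 5 → ℝ} (hq : q ∈ paramDomain) :
    LinearIndependent ℝ (basisVec 1 q) := by
  obtain ⟨hu, hv⟩ := hq
  have hC : √(latConst 1) ≠ 0 := (Real.sqrt_pos.2 latConst_one_pos).ne'
  have hs : √(q 0) ≠ 0 := (Real.sqrt_pos.2 hu).ne'
  rw [Fintype.linearIndependent_iff]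
  intro g hg
  have e : ∀ i, (∑ j, g j • basisVec 1 q j).ofLp i = 0 := fun i => by rw [hg]; rfl
  have e0 := e 0
  have e1 := e 1
  have e2 := e 2
  simp [basisVec, Fin.sum_univ_three, hC, hu.ne', hv.ne'] at e0 e1 e2
  have e1' : g 1 = 0 := by simpa [e2, hC, hs, hv.ne'] using e1
  have e0' : g 0 = 0 := by simpa [e2, e1', hC, hs, hv.ne'] using e0
  intro i
  fin_cases i <;> assumption

theorem latticeEnergy_span {v : Fin 3 → E3} (hv : LinearIndependent ℝ v) (f : ℝ → ℝ) :
    latticeEnergy f (Submodule.span ℤ (Set.range v)) =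
      ∑' n : {n : Fin 3 → ℤ // n ≠ 0}, f (‖∑ i, (n : Fin 3 → ℤ) i • v i‖ ^ 2) := by
  have hz : ∀ n : Fin 3 → ℤ, ∑ i, n i • v i = 0 → n = 0 := by
    intro n hn
    have h := Fintype.linearIndependent_iff.1 hv (fun i => (n i : ℝ)) (by
      simpa [Int.cast_smul_eq_zsmul] using hn)
    ext i
    exact_mod_cast h i
  let φ : {n : Fin 3 → ℤ // n ≠ 0} →
      {p : E3 // p ∈ Submodule.span ℤ (Set.range v) ∧ p ≠ 0} := fun n =>
    ⟨∑ i, (n : Fin 3 → ℤ) i • v i,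
      Submodule.sum_mem _ fun i _ => Submodule.smul_mem _ _ (Submodule.subset_span ⟨i, rfl⟩),
      fun h => n.2 (hz _ h)⟩
  have hφ : Function.Bijective φ := by
    constructor
    · intro n m hnm
      have h : ∑ i, (n : Fin 3 → ℤ) i • v i = ∑ i, (m : Fin 3 → ℤ) i • v i :=
        congrArg Subtype.val hnm
      have := hz ((n : Fin 3 → ℤ) - m) (by
        simp only [Pi.sub_apply, sub_smul, Finset.sum_sub_distrib]
        rw [h, sub_self])
      exact Subtype.ext (sub_eq_zero.1 this)
    · rintro ⟨p, hp, hp0⟩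
      obtain ⟨n, rfl⟩ := (Submodule.mem_span_range_iff_exists_fun ℤ).1 hp
      exact ⟨⟨n, fun h => hp0 (by simp [h])⟩, rfl⟩
  exact ((Equiv.ofBijective φ hφ).tsum_eq fun p => f (‖(p : E3)‖ ^ 2)).symm

theorem norm_sq_sum_basisVec {q : Fin 5 → ℝ} (hq : q ∈ paramDomain) (n : Fin 3 → ℤ) :
    ‖∑ i, n i • basisVec 1 q i‖ ^ 2 = qform (gramMat q) n := by
  rw [← real_inner_self_eq_norm_sq, sum_inner]
  refine Finset.sum_congr rfl fun i _ => ?_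
  rw [inner_sum]
  refine Finset.sum_congr rfl fun j _ => ?_
  rw [← inner_basisVec hq, ← Int.cast_smul_eq_zsmul ℝ, ← Int.cast_smul_eq_zsmul ℝ,
    real_inner_smul_left, real_inner_smul_right]
  ring

theorem paramEnergy_eq {q : Fin 5 → ℝ} (hq : q ∈ paramDomain) (α : ℝ) :
    paramEnergy (gaussPotential α) 1 q = gramEnergy α (gramMat q) := by
  rw [paramEnergy, paramLattice, latticeEnergy_span (linearIndependent_basisVec hq)]
  exact tsum_congr fun n => by rw [norm_sq_sum_basisVec hq, gaussPotential]

/-- The parametrization is a Cholesky decomposition, so triangular Poisson summation applies to it.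
-/
theorem qform_gramMat (q : Fin 5 → ℝ) (n : Fin 3 → ℤ) (α : ℝ) :
    α * qform (gramMat q) n = triForm (α * latConst 1 / q 0) (α * latConst 1 * q 1 ^ 2 / q 0)
      (α * latConst 1 * q 0 ^ 2 / (2 * q 1 ^ 2)) (q 2) (q 3) (q 4) n := by
  simp [qform, gramMat, triForm, Fin.sum_univ_three]
  ring

theorem det_gramMat {q : Fin 5 → ℝ} (hq : q ∈ paramDomain) : (gramMat q).det = 1 := by
  obtain ⟨hu, hv⟩ := hq
  have h := latConst_one_pow
  have e : (gramMat q).det = latConst 1 ^ 3 / 2 := by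
    simp [Matrix.det_fin_three, gramMat]
    field_simp
    ring
  rw [e, h]; norm_num

/-! ### Duality -/

/-- The parameters of the dual lattice. -/
def dualParam (q : Fin 5 → ℝ) : Fin 5 → ℝ :=
  ![latConst 1 ^ 2 * q 0 ^ 2 / (2 * q 1 ^ 2), q 0 * √(q 0) / (√2 * q 1 ^ 2), -q 4,
    q 2 * q 4 - q 3, -q 2]

theorem dualParam_mem {q : Fin 5 → ℝ} (hq : q ∈ paramDomain) : dualParam q ∈ paramDomain := by
  obtain ⟨hu, hv⟩ := hq
  have hC := latConst_one_pos
  have hs := Real.sqrt_pos.2 hu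
  constructor <;> simp [dualParam] <;> positivity

/-- Adding `1` restores the zero vector and makes the energy a full theta series. Volume one makes
the prefactor independent of `q`, which is what lets extremality transfer. -/
theorem paramEnergy_dual {α : ℝ} (hα : 0 < α) {q : Fin 5 → ℝ} (hq : q ∈ paramDomain) :
    1 + paramEnergy (gaussPotential α) 1 q =
      √(π ^ 3 / α ^ 3) * (1 + paramEnergy (gaussPotential (π ^ 2 / α)) 1 (dualParam q)) := by
  have full : ∀ {α : ℝ}, 0 < α → ∀ {q : Fin 5 → ℝ}, q ∈ paramDomain →
      1 + paramEnergy (gaussPotential α) 1 q =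
        ∑' n, Real.exp (-triForm (α * latConst 1 / q 0) (α * latConst 1 * q 1 ^ 2 / q 0)
      (α * latConst 1 * q 0 ^ 2 / (2 * q 1 ^ 2)) (q 2) (q 3) (q 4) n) := by
    intro α hα q hq
    have hC := latConst_one_pos
    have hs := summable_exp_neg_triForm (a := α * latConst 1 / q 0)
      (b := α * latConst 1 * q 1 ^ 2 / q 0) (c := α * latConst 1 * q 0 ^ 2 / (2 * q 1 ^ 2))
      (by have := hq.1; positivity) (by have := hq.1; have := hq.2; positivity)
      (by have := hq.1; have := hq.2; positivity) (q 2) (q 3) (q 4)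
    rw [paramEnergy_eq hq, gramEnergy, ← hs.tsum_subtype_add_tsum_subtype_compl {0}]
    congr 1
    · rw [tsum_singleton (0 : Fin 3 → ℤ) (f := fun n => Real.exp (-triForm _ _ _ _ _ _ n))]
      simp [triForm]
    · refine tsum_congr fun n => ?_
      rw [← qform_gramMat, neg_mul]
  have hπ := Real.pi_pos
  rw [full hα hq, full (by positivity) (dualParam_mem hq)]
  obtain ⟨hu, hv⟩ := hq
  have hC := latConst_one_pos
  rw [tsum_exp_neg_triForm (by positivity) (by positivity) (by positivity)]
  congr 1
  · rw [← Real.sqrt_mul (by positivity), ← Real.sqrt_mul (by positivity)]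
    congr 1
    have h := latConst_one_pow
    field_simp
    linear_combination (-1) * h
  · refine tsum_congr fun n => ?_
    obtain ⟨s, hs, hsu, hsu'⟩ : ∃ s > 0, √(q 0) = s ∧ q 0 = s ^ 2 :=
      ⟨_, Real.sqrt_pos.2 hu, rfl, (Real.sq_sqrt hu.le).symm⟩
    obtain ⟨t, h20, ht, h2⟩ : ∃ t > 0, √2 = t ∧ t ^ 2 = 2 :=
      ⟨_, Real.sqrt_pos.2 zero_lt_two, rfl, Real.sq_sqrt zero_le_two⟩
    have h3 := latConst_one_pow
    congr 3
    · simp [dualParam]; field_simp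
    · simp [dualParam, hsu, ht]
      rw [hsu']; field_simp; rw [h2]
    · simp [dualParam, hsu, ht]
      rw [hsu']; field_simp
      rw [h2, show latConst 1 ^ 6 = (latConst 1 ^ 3) ^ 2 by ring, h3]; norm_num

theorem dualParam_dualParam {q : Fin 5 → ℝ} (hq : q ∈ paramDomain) :
    dualParam (dualParam q) = q := by
  obtain ⟨hu, hv⟩ := hq
  obtain ⟨s, hs, hsu, hsu'⟩ : ∃ s > 0, √(q 0) = s ∧ q 0 = s ^ 2 :=
    ⟨_, Real.sqrt_pos.2 hu, rfl, (Real.sq_sqrt hu.le).symm⟩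
  obtain ⟨t, h20, ht, h2⟩ : ∃ t > 0, √2 = t ∧ t ^ 2 = 2 :=
    ⟨_, Real.sqrt_pos.2 zero_lt_two, rfl, Real.sq_sqrt zero_le_two⟩
  have h3 := latConst_one_pow
  have hC := latConst_one_pos
  have hr : √(latConst 1 ^ 2 * q 0 ^ 2 / (2 * q 1 ^ 2)) = latConst 1 * s ^ 2 / (t * q 1) := by
    rw [← Real.sqrt_sq (by positivity : 0 ≤ latConst 1 * s ^ 2 / (t * q 1)), hsu']
    congr 1
    field_simp
    rw [h2]
  have e : dualParam q = ![latConst 1 ^ 2 * q 0 ^ 2 / (2 * q 1 ^ 2), q 0 * √(q 0) / (√2 * q 1 ^ 2),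
    -q 4, q 2 * q 4 - q 3, -q 2] := rfl
  ext i
  rw [dualParam, e]
  fin_cases i
  · simp [hsu, ht]
    rw [hsu']; field_simp
    rw [h2, show latConst 1 ^ 6 = (latConst 1 ^ 3) ^ 2 by ring, h3]; norm_num
  · simp [hsu, hr, ht]
    rw [hsu']; field_simp
    exact h3
  · simp
  · simp; ring
  · simp

/-! ### Dual lattices -/

theorem mem_dualLattice {L : Submodule ℤ E3} {x : E3} :
    x ∈ dualLattice L ↔ ∀ y ∈ L, ∃ m : ℤ, (m : ℝ) = inner ℝ x y := by
  rw [dualLattice, LinearMap.BilinForm.mem_dualSubmodule]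
  simp [Submodule.mem_one]

theorem dualLattice_span {v w : Fin 3 → E3} (hv : LinearIndependent ℝ v)
    (hw : ∀ i j, inner ℝ (w i) (v j) = if i = j then (1 : ℝ) else 0) :
    dualLattice (Submodule.span ℤ (Set.range v)) = Submodule.span ℤ (Set.range w) := by
  have key : ∀ (n : Fin 3 → ℤ) j, inner ℝ (∑ i, n i • w i) (v j) = (n j : ℝ) := by
    intro n j
    simp [sum_inner, ← Int.cast_smul_eq_zsmul ℝ, real_inner_smul_left, hw]
  ext x
  rw [mem_dualLattice, Submodule.mem_span_range_iff_exists_fun]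
  constructor
  · intro h
    choose n hn using fun j => h (v j) (Submodule.subset_span ⟨j, rfl⟩)
    refine ⟨n, ?_⟩
    have htop : Submodule.span ℝ (Set.range v) = ⊤ :=
      hv.span_eq_top_of_card_eq_finrank (by simp)
    refine ext_inner_right ℝ fun y => ?_
    obtain ⟨c, rfl⟩ := (Submodule.mem_span_range_iff_exists_fun ℝ).1
      (htop ▸ Submodule.mem_top : y ∈ Submodule.span ℝ (Set.range v))
    simp_rw [inner_sum, real_inner_smul_right, key, hn]
  · rintro ⟨n, rfl⟩ y hy
    obtain ⟨m, rfl⟩ := (Submodule.mem_span_range_iff_exists_fun ℤ).1 hy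
    refine ⟨∑ j, m j * n j, ?_⟩
    simp_rw [inner_sum, ← Int.cast_smul_eq_zsmul ℝ (m _), real_inner_smul_right, key]
    push_cast
    rfl

/-- The isometry reversing the order of the coordinates. -/
def revIsometry : E3 ≃ₗᵢ[ℝ] E3 := LinearIsometryEquiv.piLpCongrLeft 2 ℝ ℝ Fin.revPerm

theorem revIsometry_apply (x : E3) (i : Fin 3) : (revIsometry x).ofLp i = x.ofLp i.rev := by
  rfl

/-- The dual of a triangular basis is triangular the opposite way; reversing both the coordinates
and the order of the vectors restores the normal form. -/
theorem inner_revIsometry_basisVec {q : Fin 5 → ℝ} (hq : q ∈ paramDomain) (i j : Fin 3) :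
    inner ℝ (revIsometry (basisVec 1 (dualParam q) i.rev)) (basisVec 1 q j) =
      if i = j then (1 : ℝ) else 0 := by
  obtain ⟨hu, hv⟩ := hq
  obtain ⟨c, hc, hC, hC'⟩ : ∃ c > 0, √(latConst 1) = c ∧ latConst 1 = c ^ 2 :=
    ⟨_, Real.sqrt_pos.2 latConst_one_pos, rfl, (Real.sq_sqrt latConst_one_pos.le).symm⟩
  obtain ⟨s, hs, hsu, hsu'⟩ : ∃ s > 0, √(q 0) = s ∧ q 0 = s ^ 2 :=
    ⟨_, Real.sqrt_pos.2 hu, rfl, (Real.sq_sqrt hu.le).symm⟩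
  have ht : √2 = c ^ 3 := by rw [sqrt_two_eq, hC]
  have h2 : (2 : ℝ) = c ^ 6 := by
    rw [← latConst_one_pow, hC']; ring
  have hr : √(latConst 1 ^ 2 * q 0 ^ 2 / (2 * q 1 ^ 2)) = s ^ 2 / (c * q 1) := by
    rw [← Real.sqrt_sq (by positivity : 0 ≤ s ^ 2 / (c * q 1)), hsu', h2, hC']
    congr 1
    field_simp
  rw [PiLp.inner_apply, Fin.sum_univ_three]
  simp only [RCLike.inner_apply, conj_trivial, revIsometry_apply]
  fin_cases i <;> fin_cases j <;> simp [basisVec, dualParam, hC, hsu, ht, hr] <;>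
    (try simp only [hC', hsu']) <;> (try field_simp) <;> (try simp only [h2]) <;> (try ring)

theorem image_paramLattice_dualParam {q : Fin 5 → ℝ} (hq : q ∈ paramDomain) :
    revIsometry '' (paramLattice 1 (dualParam q) : Set E3) =
      (dualLattice (paramLattice 1 q) : Set E3) := by
  rw [paramLattice, paramLattice, dualLattice_span (linearIndependent_basisVec hq)
    (inner_revIsometry_basisVec hq)]
  have h := Submodule.map_span (revIsometry.toLinearEquiv.toLinearMap.restrictScalars ℤ)
    (Set.range (basisVec 1 (dualParam q)))
  have e : (revIsometry '' (Submodule.span ℤ (Set.range (basisVec 1 (dualParam q))) : Set E3)) =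
    (Submodule.map (revIsometry.toLinearEquiv.toLinearMap.restrictScalars ℤ)
      (Submodule.span ℤ (Set.range (basisVec 1 (dualParam q)))) : Set E3) := rfl
  rw [e, h]
  congr 2
  ext x
  constructor
  · rintro ⟨_, ⟨i, rfl⟩, rfl⟩
    exact ⟨i.rev, by simp⟩
  · rintro ⟨i, rfl⟩
    exact ⟨_, ⟨i.rev, rfl⟩, rfl⟩

theorem image_dualLattice {L L' : Submodule ℤ E3} (O : E3 ≃ₗᵢ[ℝ] E3)
    (h : O '' (L : Set E3) = (L' : Set E3)) :
    O '' (dualLattice L : Set E3) = (dualLattice L' : Set E3) := by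
  have hL' : ∀ y, y ∈ L' ↔ ∃ x ∈ L, O x = y := fun y => by
    rw [← SetLike.mem_coe, ← h]; rfl
  ext x
  rw [SetLike.mem_coe, mem_dualLattice]
  constructor
  · rintro ⟨z, hz, rfl⟩ y hy
    obtain ⟨y, hyL, rfl⟩ := (hL' y).1 hy
    rw [O.inner_map_map]
    exact mem_dualLattice.1 hz y hyL
  · intro hx
    refine ⟨O.symm x, mem_dualLattice.2 fun y hy => ?_, by simp⟩
    obtain ⟨m, hm⟩ := hx (O y) ((hL' _).2 ⟨y, hy, rfl⟩)
    refine ⟨m, ?_⟩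
    rw [hm, ← O.inner_map_map (O.symm x), O.apply_symm_apply]

theorem Parametrizes.dual {q : Fin 5 → ℝ} {L : Submodule ℤ E3} (h : Parametrizes 1 q L) :
    Parametrizes 1 (dualParam q) (dualLattice L) := by
  obtain ⟨hq, O, hO⟩ := h
  refine ⟨dualParam_mem hq, revIsometry.trans O, ?_⟩
  rw [← image_dualLattice O hO, ← image_paramLattice_dualParam hq, Set.image_image]
  rfl

theorem dualLattice_dualLattice {L : Submodule ℤ E3} {q : Fin 5 → ℝ} (h : Parametrizes 1 q L) :
    dualLattice (dualLattice L) = L := by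
  obtain ⟨hq, O, hO⟩ := h
  have h1 := image_dualLattice O (image_dualLattice O hO)
  have hd : dualLattice (dualLattice (paramLattice 1 q)) = paramLattice 1 q := by
    have h2 := image_dualLattice revIsometry (image_paramLattice_dualParam hq)
    rw [← image_paramLattice_dualParam (dualParam_mem hq), dualParam_dualParam hq,
      Set.image_image] at h2
    refine SetLike.coe_injective (h2.symm.trans ?_)
    have hrev : ∀ x, revIsometry (revIsometry x) = x := fun x => by
      ext i; simp [revIsometry_apply]
    simp [hrev]
  rw [hd, hO] at h1
  exact SetLike.coe_injective h1.symm

/-! ### Transfer of critical points by duality -/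

theorem eventually_mem_paramDomain {q : Fin 5 → ℝ} (hq : q ∈ paramDomain) :
    ∀ᶠ p in 𝓝 q, p ∈ paramDomain := by
  have h : IsOpen paramDomain :=
    (isOpen_lt continuous_const (continuous_apply 0)).inter
      (isOpen_lt continuous_const (continuous_apply 1))
  exact h.mem_nhds hq

theorem differentiableAt_dualParam {q : Fin 5 → ℝ} (hq : q ∈ paramDomain) :
    DifferentiableAt ℝ dualParam q := by
  obtain ⟨hu, hv⟩ := hq
  have h0 : ∀ i : Fin 5, DifferentiableAt ℝ (fun p : Fin 5 → ℝ => p i) q := fun i => by fun_prop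
  have hs : DifferentiableAt ℝ (fun p : Fin 5 → ℝ => √(p 0)) q := (h0 0).sqrt hu.ne'
  refine differentiableAt_pi.2 fun i => ?_
  fin_cases i <;> simp only [dualParam, Fin.zero_eta, Fin.mk_one, Fin.reduceFinMk, Matrix.cons_val]
  · fun_prop (disch := positivity)
  · fun_prop (disch := positivity)
  · fun_prop
  · fun_prop
  · fun_prop

theorem sqrt_pi_div_pos {α : ℝ} (hα : 0 < α) : 0 < √(π ^ 3 / α ^ 3) := by
  have := Real.pi_pos
  positivity

theorem eventually_paramEnergy_dual {α : ℝ} (hα : 0 < α) {q : Fin 5 → ℝ} (hq : q ∈ paramDomain) :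
    paramEnergy (gaussPotential α) 1 =ᶠ[𝓝 q] fun p => √(π ^ 3 / α ^ 3) *
      (1 + paramEnergy (gaussPotential (π ^ 2 / α)) 1 (dualParam p)) - 1 := by
  filter_upwards [eventually_mem_paramDomain hq] with p hp
  rw [← paramEnergy_dual hα hp]
  ring

theorem isLocalMin_paramEnergy_dual {α : ℝ} (hα : 0 < α) {q : Fin 5 → ℝ} (hq : q ∈ paramDomain)
    (h : IsLocalMin (paramEnergy (gaussPotential (π ^ 2 / α)) 1) (dualParam q)) :
    IsLocalMin (paramEnergy (gaussPotential α) 1) q := by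
  have h1 := (differentiableAt_dualParam hq).continuousAt.eventually h
  have he := eventually_paramEnergy_dual hα hq
  filter_upwards [h1, he] with p hp hep
  rw [he.self_of_nhds, hep]
  have := sqrt_pi_div_pos hα
  beta_reduce
  gcongr

theorem isLocalMax_paramEnergy_dual {α : ℝ} (hα : 0 < α) {q : Fin 5 → ℝ} (hq : q ∈ paramDomain)
    (h : IsLocalMax (paramEnergy (gaussPotential (π ^ 2 / α)) 1) (dualParam q)) :
    IsLocalMax (paramEnergy (gaussPotential α) 1) q := by
  have h1 := (differentiableAt_dualParam hq).continuousAt.eventually h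
  have he := eventually_paramEnergy_dual hα hq
  filter_upwards [h1, he] with p hp hep
  rw [he.self_of_nhds, hep]
  have := sqrt_pi_div_pos hα
  beta_reduce
  gcongr

/-- The two negative conditions need the transfer in the opposite direction, available because
`dualParam` and `α ↦ π²/α` are involutions. -/
theorem isSaddleParam_dual {α : ℝ} (hα : 0 < α) {q : Fin 5 → ℝ} (hq : q ∈ paramDomain)
    (h : IsSaddleParam (gaussPotential (π ^ 2 / α)) 1 (dualParam q)) :
    IsSaddleParam (gaussPotential α) 1 q := by
  obtain ⟨hd, hmin, hmax⟩ := h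
  have hπ := Real.pi_pos
  have hα' : 0 < π ^ 2 / α := by positivity
  have hαα : π ^ 2 / (π ^ 2 / α) = α := by field_simp
  refine ⟨?_, fun hm => hmin ?_, fun hm => hmax ?_⟩
  · have hc := hd.comp q (differentiableAt_dualParam hq).hasFDerivAt
    have h2 := ((hc.const_add 1).const_mul (√(π ^ 3 / α ^ 3))).sub_const 1
    refine (h2.congr_of_eventuallyEq (eventually_paramEnergy_dual hα hq)).congr_fderiv ?_
    simp
  · refine isLocalMin_paramEnergy_dual hα' (dualParam_mem hq) ?_
    rwa [dualParam_dualParam hq, hαα]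
  · refine isLocalMax_paramEnergy_dual hα' (dualParam_mem hq) ?_
    rwa [dualParam_dualParam hq, hαα]

theorem IsLocalMinimizer.dual {α : ℝ} (hα : 0 < α) {L : Submodule ℤ E3}
    (h : IsLocalMinimizer (gaussPotential (π ^ 2 / α)) 1 L) :
    IsLocalMinimizer (gaussPotential α) 1 (dualLattice L) := by
  obtain ⟨⟨q₀, hq₀⟩, h⟩ := h
  refine ⟨⟨_, hq₀.dual⟩, fun q hq => isLocalMin_paramEnergy_dual hα hq.1 (h _ ?_)⟩
  have := hq.dual
  rwa [dualLattice_dualLattice hq₀] at this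

theorem IsSaddlePoint.dual {α : ℝ} (hα : 0 < α) {L : Submodule ℤ E3}
    (h : IsSaddlePoint (gaussPotential (π ^ 2 / α)) 1 L) :
    IsSaddlePoint (gaussPotential α) 1 (dualLattice L) := by
  obtain ⟨⟨q₀, hq₀⟩, h⟩ := h
  refine ⟨⟨_, hq₀.dual⟩, fun q hq => isSaddleParam_dual hα hq.1 (h _ ?_)⟩
  have := hq.dual
  rwa [dualLattice_dualLattice hq₀] at this

theorem parametrizes_fcc : Parametrizes 1 ![1, 1, 0, 1 / 2, 1 / 2] (fcc 1) :=
  ⟨⟨by simp, by simp⟩, LinearIsometryEquiv.refl ℝ E3, by simp [fcc]⟩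

/-! ### Change of basis -/

/-- Gram matrices forget the isometry, leaving only an integral change of basis. This reduces the
quantifier over all parametrizations to one reference point. -/
theorem exists_gramMat_eq {q q₁ : Fin 5 → ℝ} (hq₁ : q₁ ∈ paramDomain)
    (h : Parametrizes 1 q (paramLattice 1 q₁)) :
    ∃ T T' : Matrix (Fin 3) (Fin 3) ℤ, T * T' = 1 ∧
      gramMat q = (T.map (Int.cast : ℤ → ℝ))ᵀ * gramMat q₁ * T.map (Int.cast : ℤ → ℝ) := by
  obtain ⟨hq, O, hO⟩ := h
  have h1 : ∀ i, ∃ c : Fin 3 → ℤ, ∑ k, c k • basisVec 1 q₁ k = O (basisVec 1 q i) := by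
    intro i
    have : O (basisVec 1 q i) ∈ (paramLattice 1 q₁ : Set E3) :=
      hO ▸ ⟨_, Submodule.subset_span ⟨i, rfl⟩, rfl⟩
    exact (Submodule.mem_span_range_iff_exists_fun ℤ).1 this
  have h2 : ∀ j, ∃ c : Fin 3 → ℤ, ∑ i, c i • O (basisVec 1 q i) = basisVec 1 q₁ j := by
    intro j
    have : basisVec 1 q₁ j ∈ (paramLattice 1 q₁ : Set E3) := Submodule.subset_span ⟨j, rfl⟩
    rw [← hO] at this
    obtain ⟨w, hw, hwj⟩ := this
    obtain ⟨c, rfl⟩ := (Submodule.mem_span_range_iff_exists_fun ℤ).1 hw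
    refine ⟨c, ?_⟩
    rw [← hwj, map_sum]
    exact Finset.sum_congr rfl fun i _ => (map_zsmul O (c i) _).symm
  choose t ht using h1
  choose t' ht' using h2
  refine ⟨Matrix.of fun k i => t i k, Matrix.of fun i j => t' j i, ?_, ?_⟩
  · ext k j
    have hli := (linearIndependent_basisVec hq₁)
    have hsum : ∑ k, ((∑ i, t i k * t' j i : ℤ) : ℝ) • basisVec 1 q₁ k = basisVec 1 q₁ j := by
      conv_rhs => rw [← ht' j]
      simp_rw [← ht, Finset.smul_sum, Int.cast_smul_eq_zsmul, Finset.sum_smul, smul_smul]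
      rw [Finset.sum_comm]
      exact Finset.sum_congr rfl fun i _ => Finset.sum_congr rfl fun k _ => by rw [mul_comm]
    have hz : ∑ k, (((∑ i, t i k * t' j i : ℤ) : ℝ) - if k = j then 1 else 0) •
        basisVec 1 q₁ k = 0 := by
      simp only [sub_smul, Finset.sum_sub_distrib, hsum]
      simp
    have := Fintype.linearIndependent_iff.1 hli _ hz k
    rw [Matrix.mul_apply, Matrix.one_apply]
    simp only [Matrix.of_apply]
    rw [sub_eq_zero] at this
    split_ifs with hk
    · rw [if_pos hk] at this; exact_mod_cast this
    · rw [if_neg hk] at this; exact_mod_cast this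
  · ext i j
    rw [← inner_basisVec hq, ← O.inner_map_map, ← ht, ← ht, sum_inner, Matrix.mul_apply]
    simp_rw [inner_sum, ← Int.cast_smul_eq_zsmul ℝ, real_inner_smul_left, real_inner_smul_right,
      inner_basisVec hq₁, Matrix.mul_apply, Finset.sum_mul]
    rw [Finset.sum_comm]
    refine Finset.sum_congr rfl fun l _ => Finset.sum_congr rfl fun k _ => ?_
    simp
    ring

/-! ### Frames -/

/-- The lattice with parameters `q` is similar to `Λ ∪ {0}`: its basis corresponds to the columns
of the integer matrix `P`, with squared similarity ratio `r`. -/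
structure Frame (Λ : Set (Fin 3 → ℤ)) (q : Fin 5 → ℝ) (r : ℝ)
    (P : Matrix (Fin 3) (Fin 3) ℤ) : Prop where
  mem : q ∈ paramDomain
  pos : 0 < r
  gram : gramMat q = r • ((P.map (Int.cast : ℤ → ℝ))ᵀ * P.map (Int.cast : ℤ → ℝ))
  mem_iff : ∀ k, k ∈ Λ ↔ ∃ n, n ≠ 0 ∧ P *ᵥ n = k

variable {q : Fin 5 → ℝ} {r : ℝ} {P : Matrix (Fin 3) (Fin 3) ℤ}

theorem Frame.exists_of_parametrizes {q₁ : Fin 5 → ℝ} (hF : Frame Λ q₁ r P)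
    (h : Parametrizes 1 q (paramLattice 1 q₁)) : ∃ P', Frame Λ q r P' := by
  obtain ⟨T, T', hT, hG⟩ := exists_gramMat_eq hF.mem h
  have hT' : T' * T = 1 := mul_eq_one_comm.1 hT
  refine ⟨P * T, h.1, hF.pos, ?_, fun k => ?_⟩
  · have e : (P * T).map (Int.cast : ℤ → ℝ) =
        P.map (Int.cast : ℤ → ℝ) * T.map (Int.cast : ℤ → ℝ) :=
      Matrix.map_mul (f := Int.castRingHom ℝ)
    rw [hG, hF.gram, e, Matrix.transpose_mul]
    simp only [Matrix.mul_smul, Matrix.smul_mul, Matrix.mul_assoc]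
  · rw [hF.mem_iff]
    constructor
    · rintro ⟨n, hn, rfl⟩
      refine ⟨T' *ᵥ n, fun h0 => hn ?_, ?_⟩
      · have := congrArg (T *ᵥ ·) h0
        simpa [Matrix.mulVec_mulVec, hT] using this
      · rw [Matrix.mulVec_mulVec, Matrix.mul_assoc, hT, Matrix.mul_one]
    · rintro ⟨n, hn, rfl⟩
      refine ⟨T *ᵥ n, fun h0 => hn ?_, by rw [Matrix.mulVec_mulVec]⟩
      have := congrArg (T' *ᵥ ·) h0
      simpa [Matrix.mulVec_mulVec, hT'] using this

theorem qform_eq (S : Matrix (Fin 3) (Fin 3) ℝ) (k : Fin 3 → ℤ) :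
    qform S k = (fun i => (k i : ℝ)) ⬝ᵥ S *ᵥ fun i => (k i : ℝ) := by
  simp only [qform, dotProduct, Matrix.mulVec, Finset.mul_sum]
  exact Finset.sum_congr rfl fun i _ => Finset.sum_congr rfl fun j _ => by ring

theorem qform_conj (S : Matrix (Fin 3) (Fin 3) ℝ) (r : ℝ) (P : Matrix (Fin 3) (Fin 3) ℤ)
    (n : Fin 3 → ℤ) :
    qform (r • ((P.map (Int.cast : ℤ → ℝ))ᵀ * S * P.map (Int.cast : ℤ → ℝ))) n =
      r * qform S (P *ᵥ n) := by
  have e : (fun i => ((P *ᵥ n) i : ℝ)) = P.map (Int.cast : ℤ → ℝ) *ᵥ fun i => (n i : ℝ) := by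
    ext i
    simp [Matrix.mulVec, dotProduct]
  rw [qform_eq, qform_eq, e, Matrix.smul_mulVec, dotProduct_smul, smul_eq_mul,
    ← Matrix.mulVec_mulVec, ← Matrix.mulVec_mulVec, Matrix.dotProduct_mulVec,
    Matrix.vecMul_transpose]

theorem Frame.det_mul (hF : Frame Λ q r P) :
    r ^ 3 * (P.map (Int.cast : ℤ → ℝ)).det ^ 2 = 1 := by
  have h := det_gramMat hF.mem
  rw [hF.gram, Matrix.det_smul, Matrix.det_mul, Matrix.det_transpose, Fintype.card_fin] at h
  rw [← h]; ring

theorem Frame.isUnit_det (hF : Frame Λ q r P) : IsUnit (P.map (Int.cast : ℤ → ℝ)).det := by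
  rw [isUnit_iff_ne_zero]
  intro h
  have := hF.det_mul
  rw [h] at this
  norm_num at this

theorem Frame.gramEnergy_eq (hF : Frame Λ q r P) (α : ℝ) (S : Matrix (Fin 3) (Fin 3) ℝ) :
    gramEnergy α (r • ((P.map (Int.cast : ℤ → ℝ))ᵀ * S * P.map (Int.cast : ℤ → ℝ))) =
      cubicEnergy Λ (α * r) S := by
  let φ : {n : Fin 3 → ℤ // n ≠ 0} → Λ := fun n =>
    ⟨P *ᵥ (n : Fin 3 → ℤ), (hF.mem_iff _).2 ⟨n, n.2, rfl⟩⟩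
  have hφ : Function.Bijective φ := by
    constructor
    · intro n m hnm
      have h : P *ᵥ (n : Fin 3 → ℤ) = P *ᵥ (m : Fin 3 → ℤ) := congrArg Subtype.val hnm
      have hdet : P.det ≠ 0 := by
        intro h0
        have := hF.isUnit_det.ne_zero
        have e : (P.map (Int.cast : ℤ → ℝ)).det = ((P.det : ℤ) : ℝ) :=
          ((Int.castRingHom ℝ).map_det P).symm
        rw [e, h0] at this
        simp at this
      exact Subtype.ext (Matrix.mulVec_injective_of_det_ne_zero hdet h)
    · rintro ⟨k, hk⟩
      obtain ⟨n, hn, rfl⟩ := (hF.mem_iff k).1 hk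
      exact ⟨⟨n, hn⟩, rfl⟩
  rw [cubicEnergy, ← (Equiv.ofBijective φ hφ).tsum_eq, gramEnergy]
  refine tsum_congr fun n => ?_
  rw [qform_conj]
  congr 1
  simp only [Equiv.ofBijective_apply, φ]
  ring

/-- The Gram matrix at `p`, read in the coordinates of a frame. -/
def frameForm (r : ℝ) (P : Matrix (Fin 3) (Fin 3) ℤ) (p : Fin 5 → ℝ) : Matrix (Fin 3) (Fin 3) ℝ :=
  r⁻¹ • (((P.map (Int.cast : ℤ → ℝ))⁻¹)ᵀ * gramMat p * (P.map (Int.cast : ℤ → ℝ))⁻¹)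

theorem Frame.conj_frameForm (hF : Frame Λ q r P) (p : Fin 5 → ℝ) :
    r • ((P.map (Int.cast : ℤ → ℝ))ᵀ * frameForm r P p * P.map (Int.cast : ℤ → ℝ)) =
      gramMat p := by
  have h := hF.isUnit_det
  set R := P.map (Int.cast : ℤ → ℝ)
  rw [frameForm, Matrix.mul_smul, Matrix.smul_mul, smul_smul, mul_inv_cancel₀ hF.pos.ne', one_smul,
    ← Matrix.mul_assoc, ← Matrix.mul_assoc, ← Matrix.transpose_mul, Matrix.nonsing_inv_mul _ h,
    Matrix.transpose_one, Matrix.one_mul, Matrix.mul_assoc, Matrix.nonsing_inv_mul _ h,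
    Matrix.mul_one]

theorem Frame.frameForm_self (hF : Frame Λ q r P) : frameForm r P q = 1 := by
  have h := hF.isUnit_det
  rw [frameForm, hF.gram]
  set R := P.map (Int.cast : ℤ → ℝ)
  rw [Matrix.mul_smul, Matrix.smul_mul, smul_smul, inv_mul_cancel₀ hF.pos.ne', one_smul,
    ← Matrix.mul_assoc, ← Matrix.transpose_mul, Matrix.mul_nonsing_inv _ h,
    Matrix.transpose_one, Matrix.one_mul, Matrix.mul_nonsing_inv _ h]

theorem Frame.det_frameForm (hF : Frame Λ q r P) {p : Fin 5 → ℝ} (hp : p ∈ paramDomain) :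
    (frameForm r P p).det = 1 := by
  have h := congrArg Matrix.det (hF.conj_frameForm p)
  rw [det_gramMat hp, Matrix.det_smul, Matrix.det_mul, Matrix.det_mul, Matrix.det_transpose,
    Fintype.card_fin] at h
  have h2 := hF.det_mul
  linear_combination h - (frameForm r P p).det * h2

theorem isSymm_gramMat (p : Fin 5 → ℝ) : (gramMat p).IsSymm := by
  ext i j
  fin_cases i <;> fin_cases j <;> simp [gramMat]

theorem isSymm_frameForm (r : ℝ) (P : Matrix (Fin 3) (Fin 3) ℤ) (p : Fin 5 → ℝ) :
    (frameForm r P p).IsSymm := by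
  rw [Matrix.IsSymm, frameForm, Matrix.transpose_smul, Matrix.transpose_mul, Matrix.transpose_mul,
    Matrix.transpose_transpose, (isSymm_gramMat p).eq, Matrix.mul_assoc]

theorem Frame.paramEnergy_eq (hF : Frame Λ q r P) {p : Fin 5 → ℝ} (hp : p ∈ paramDomain) (α : ℝ) :
    paramEnergy (gaussPotential α) 1 p = cubicEnergy Λ (α * r) (frameForm r P p) := by
  rw [CubicLattices.paramEnergy_eq hp, ← hF.gramEnergy_eq, hF.conj_frameForm]

theorem differentiableAt_gramMat (hq : q ∈ paramDomain) (i j : Fin 3) :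
    DifferentiableAt ℝ (fun p => gramMat p i j) q := by
  obtain ⟨hu, hv⟩ := hq
  fin_cases i <;> fin_cases j <;>
    simp only [gramMat, Fin.zero_eta, Fin.mk_one, Fin.reduceFinMk, Matrix.of_apply,
      Matrix.cons_val] <;>
    fun_prop (disch := positivity)

theorem differentiableAt_frameForm (r : ℝ) (P : Matrix (Fin 3) (Fin 3) ℤ) (hq : q ∈ paramDomain)
    (i j : Fin 3) : DifferentiableAt ℝ (fun p => frameForm r P p i j) q := by
  have h := differentiableAt_gramMat hq
  simp only [frameForm, Matrix.smul_apply, Matrix.mul_apply, smul_eq_mul]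
  fun_prop

theorem Frame.isBigO_frobSq (hF : Frame Λ q r P) :
    (fun p => frobSq (frameForm r P p - 1)) =O[𝓝 q] fun p => ‖p - q‖ ^ 2 := by
  unfold frobSq
  refine Asymptotics.IsBigO.fun_sum fun i _ => Asymptotics.IsBigO.fun_sum fun j _ => ?_
  have h : (fun p => frameForm r P p i j - frameForm r P q i j) =O[𝓝 q] fun p => p - q :=
    (differentiableAt_frameForm r P hF.mem i j).isBigO_sub
  rw [hF.frameForm_self] at h
  exact (Asymptotics.IsBigO.norm_right h).pow 2

theorem Frame.tendsto_frobSq (hF : Frame Λ q r P) :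
    Tendsto (fun p => frobSq (frameForm r P p - 1)) (𝓝 q) (𝓝 0) := by
  refine hF.isBigO_frobSq.trans_tendsto ?_
  have h : Continuous fun p : Fin 5 → ℝ => ‖p - q‖ ^ 2 := by fun_prop
  simpa using h.tendsto q

/-- A change of energy of order `‖p - q‖²` has derivative zero; the series is never differentiated
termwise. -/
theorem Frame.hasFDerivAt_paramEnergy (hF : Frame Λ q r P) (hΛ : IsCubic Λ) {α : ℝ} (hα : 0 < α) :
    HasFDerivAt (paramEnergy (gaussPotential α) 1) (0 : (Fin 5 → ℝ) →L[ℝ] ℝ) q := by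
  obtain ⟨C, hC⟩ := exists_abs_cubicEnergy_sub_le hΛ (mul_pos hα hF.pos)
  have h : (fun p => paramEnergy (gaussPotential α) 1 p - paramEnergy (gaussPotential α) 1 q)
      =O[𝓝 q] fun p => ‖p - q‖ ^ 2 := by
    refine Asymptotics.IsBigO.trans (Asymptotics.IsBigO.of_bound C ?_) hF.isBigO_frobSq
    filter_upwards [eventually_mem_paramDomain hF.mem,
      hF.tendsto_frobSq.eventually_le_const (show (0 : ℝ) < 1 / 4 by norm_num)] with p hp hK
    have := hC (frameForm r P p - 1) hK (by rw [add_sub_cancel]; exact hF.det_frameForm hp)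
    rw [hF.paramEnergy_eq hp, hF.paramEnergy_eq hF.mem, hF.frameForm_self, Real.norm_eq_abs,
      Real.norm_of_nonneg (frobSq_nonneg _)]
    rwa [add_sub_cancel] at this
  have h2 := (h.hasFDerivAt (𝕜 := ℝ) one_lt_two).add_const (paramEnergy (gaussPotential α) 1 q)
  simpa using h2

theorem Frame.isLocalMin_paramEnergy (hF : Frame Λ q r P) {α ε : ℝ} (hε : 0 < ε)
    (h : ∀ K : Matrix (Fin 3) (Fin 3) ℝ, K.IsSymm → (1 + K).det = 1 → frobSq K ≤ ε →
      cubicEnergy Λ (α * r) 1 ≤ cubicEnergy Λ (α * r) (1 + K)) :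
    IsLocalMin (paramEnergy (gaussPotential α) 1) q := by
  filter_upwards [eventually_mem_paramDomain hF.mem,
    hF.tendsto_frobSq.eventually_le_const hε] with p hp hK
  have := h (frameForm r P p - 1) ((isSymm_frameForm r P p).sub Matrix.isSymm_one)
    (by rw [add_sub_cancel]; exact hF.det_frameForm hp) hK
  rwa [hF.paramEnergy_eq hp, hF.paramEnergy_eq hF.mem, hF.frameForm_self, ← add_sub_cancel 1
    (frameForm r P p)]

/-! ### Parameters from the Gram matrix -/

/-- The parameters with a prescribed Gram matrix. -/
def cholParam (A : Matrix (Fin 3) (Fin 3) ℝ) : Fin 5 → ℝ :=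
  ![latConst 1 / A 0 0, √(A 1 1 / A 0 0 - (A 0 1 / A 0 0) ^ 2), A 0 1 / A 0 0, A 0 2 / A 0 0,
    (A 1 2 / A 0 0 - A 0 1 / A 0 0 * (A 0 2 / A 0 0)) / (A 1 1 / A 0 0 - (A 0 1 / A 0 0) ^ 2)]

theorem cholParam_mem {A : Matrix (Fin 3) (Fin 3) ℝ} (h0 : 0 < A 0 0)
    (h1 : 0 < A 1 1 / A 0 0 - (A 0 1 / A 0 0) ^ 2) : cholParam A ∈ paramDomain := by
  have := latConst_one_pos
  exact ⟨by simp [cholParam]; positivity, by simpa [cholParam] using h1⟩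

theorem gramMat_cholParam {A : Matrix (Fin 3) (Fin 3) ℝ} (hsym : A.IsSymm) (hdet : A.det = 1)
    (h0 : 0 < A 0 0) (h1 : 0 < A 1 1 / A 0 0 - (A 0 1 / A 0 0) ^ 2) :
    gramMat (cholParam A) = A := by
  have hC := latConst_one_pos
  have hC3 := latConst_one_pow
  have hv := Real.sq_sqrt h1.le
  have e1 : A 1 0 = A 0 1 := hsym.apply 0 1
  have e2 : A 2 0 = A 0 2 := hsym.apply 0 2
  have e3 : A 2 1 = A 1 2 := hsym.apply 1 2
  rw [Matrix.det_fin_three, e1, e2, e3] at hdet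
  have hw0 : A 1 1 / A 0 0 - (A 0 1 / A 0 0) ^ 2 = (A 0 0 * A 1 1 - A 0 1 ^ 2) / A 0 0 ^ 2 := by
    field_simp
  have hD : 0 < A 0 0 * A 1 1 - A 0 1 ^ 2 := by
    rw [hw0] at h1
    exact (div_pos_iff_of_pos_right (by positivity)).1 h1
  ext i j
  fin_cases i <;> fin_cases j <;> simp [gramMat, cholParam, hv, e1, e2, e3]
  all_goals try rw [hw0]
  all_goals field_simp
  all_goals try ring1
  -- Five entries are matched by the five parameters; the remaining one, `A 2 2`, is forced by the
  -- determinant.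
  linear_combination A 0 0 * hC3 - 2 * A 0 0 * hdet

theorem cholParam_gramMat (hq : q ∈ paramDomain) : cholParam (gramMat q) = q := by
  obtain ⟨hu, hv⟩ := hq
  have hC := latConst_one_pos
  have e : latConst 1 * (q 2 ^ 2 + q 1 ^ 2) / q 0 / (latConst 1 / q 0) -
      (latConst 1 * q 2 / q 0 / (latConst 1 / q 0)) ^ 2 = q 1 ^ 2 := by
    field_simp
    ring
  ext i
  fin_cases i
  · simp [cholParam, gramMat]; field_simp
  · simp [cholParam, gramMat, e, Real.sqrt_sq hv.le]
  · simp [cholParam, gramMat]; field_simp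
  · simp [cholParam, gramMat]; field_simp
  · simp [cholParam, gramMat, e]; field_simp; ring

theorem gramMat_pos (hq : q ∈ paramDomain) : 0 < gramMat q 0 0 ∧
    0 < gramMat q 1 1 / gramMat q 0 0 - (gramMat q 0 1 / gramMat q 0 0) ^ 2 := by
  obtain ⟨hu, hv⟩ := hq
  have hC := latConst_one_pos
  have e : latConst 1 * (q 2 ^ 2 + q 1 ^ 2) / q 0 / (latConst 1 / q 0) -
      (latConst 1 * q 2 / q 0 / (latConst 1 / q 0)) ^ 2 = q 1 ^ 2 := by
    field_simp
    ring
  constructor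
  · simp [gramMat]; positivity
  · simp [gramMat, e]; positivity

theorem continuousAt_cholParam {A : Matrix (Fin 3) (Fin 3) ℝ} (h0 : 0 < A 0 0)
    (h1 : 0 < A 1 1 / A 0 0 - (A 0 1 / A 0 0) ^ 2) : ContinuousAt cholParam A := by
  have hc : ∀ i j, ContinuousAt (fun B : Matrix (Fin 3) (Fin 3) ℝ => B i j) A :=
    fun i j => (continuous_id.matrix_elem i j).continuousAt
  have hd : ∀ i j, ContinuousAt (fun B : Matrix (Fin 3) (Fin 3) ℝ => B i j / B 0 0) A :=
    fun i j => (hc i j).div (hc 0 0) h0.ne'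
  have hw := (hd 1 1).sub ((hd 0 1).pow 2)
  refine continuousAt_pi.2 fun i => ?_
  fin_cases i
  · exact continuousAt_const.div (hc 0 0) h0.ne'
  · exact hw.sqrt
  · exact hd 0 1
  · exact hd 0 2
  · exact ((hd 1 2).sub ((hd 0 1).mul (hd 0 2))).div hw h1.ne'

/-- Symmetric forms of determinant one near the identity are realized by parameters near `q`. -/
theorem Frame.exists_path (hF : Frame Λ q r P) {S : ℝ → Matrix (Fin 3) (Fin 3) ℝ}
    {l : Filter ℝ} (hS : Tendsto S l (𝓝 1)) (hsym : ∀ᶠ t in l, (S t).IsSymm)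
    (hdet : ∀ᶠ t in l, (S t).det = 1) :
    ∃ p : ℝ → Fin 5 → ℝ, Tendsto p l (𝓝 q) ∧ ∀ α, ∀ᶠ t in l,
      paramEnergy (gaussPotential α) 1 (p t) = cubicEnergy Λ (α * r) (S t) := by
  set R := P.map (Int.cast : ℤ → ℝ) with hR
  obtain ⟨h0, h1⟩ := gramMat_pos hF.mem
  let A : ℝ → Matrix (Fin 3) (Fin 3) ℝ := fun t => r • (Rᵀ * S t * R)
  have hA : Tendsto A l (𝓝 (gramMat q)) := by
    have hc : Continuous fun B : Matrix (Fin 3) (Fin 3) ℝ => r • (Rᵀ * B * R) := by fun_prop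
    have := (hc.tendsto 1).comp hS
    rwa [Matrix.mul_one, ← hF.gram] at this
  have hp : Tendsto (fun t => cholParam (A t)) l (𝓝 q) := by
    have := (continuousAt_cholParam h0 h1).tendsto.comp hA
    rwa [cholParam_gramMat hF.mem] at this
  refine ⟨fun t => cholParam (A t), hp, fun α => ?_⟩
  have hc : ∀ i j, ContinuousAt (fun B : Matrix (Fin 3) (Fin 3) ℝ => B i j) (gramMat q) :=
    fun i j => (continuous_id.matrix_elem i j).continuousAt
  have c1 : ContinuousAt (fun B : Matrix (Fin 3) (Fin 3) ℝ =>
      B 1 1 / B 0 0 - (B 0 1 / B 0 0) ^ 2) (gramMat q) :=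
    ((hc 1 1).div (hc 0 0) h0.ne').sub (((hc 0 1).div (hc 0 0) h0.ne').pow 2)
  filter_upwards [hsym, hdet, ((hc 0 0).tendsto.comp hA).eventually_const_lt h0,
    (c1.tendsto.comp hA).eventually_const_lt h1] with t hs hd ht0 ht1
  have hAs : (A t).IsSymm := by
    simp only [A, Matrix.IsSymm, Matrix.transpose_smul, Matrix.transpose_mul,
      Matrix.transpose_transpose, hs.eq, Matrix.mul_assoc]
  have hAd : (A t).det = 1 := by
    simp only [A, Matrix.det_smul, Matrix.det_mul, Matrix.det_transpose, Fintype.card_fin, hd]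
    have h := hF.det_mul
    rw [← hR] at h
    linear_combination h
  rw [CubicLattices.paramEnergy_eq (cholParam_mem ht0 ht1), gramMat_cholParam hAs hAd ht0 ht1,
    hF.gramEnergy_eq]

theorem Frame.not_isLocalMin (hF : Frame Λ q r P) {α : ℝ} {S : ℝ → Matrix (Fin 3) (Fin 3) ℝ}
    {l : Filter ℝ} [l.NeBot] (hS : Tendsto S l (𝓝 1)) (hsym : ∀ᶠ t in l, (S t).IsSymm)
    (hdet : ∀ᶠ t in l, (S t).det = 1)
    (h : ∀ᶠ t in l, cubicEnergy Λ (α * r) (S t) < cubicEnergy Λ (α * r) 1) :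
    ¬ IsLocalMin (paramEnergy (gaussPotential α) 1) q := by
  intro hmin
  obtain ⟨p, hp, hE⟩ := hF.exists_path hS hsym hdet
  obtain ⟨t, ht, ht2, ht3⟩ := ((hp.eventually hmin).and ((hE α).and h)).exists
  rw [ht2, hF.paramEnergy_eq hF.mem, hF.frameForm_self] at ht
  exact absurd ht3 ht.not_gt

theorem Frame.not_isLocalMax (hF : Frame Λ q r P) {α : ℝ} {S : ℝ → Matrix (Fin 3) (Fin 3) ℝ}
    {l : Filter ℝ} [l.NeBot] (hS : Tendsto S l (𝓝 1)) (hsym : ∀ᶠ t in l, (S t).IsSymm)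
    (hdet : ∀ᶠ t in l, (S t).det = 1)
    (h : ∀ᶠ t in l, cubicEnergy Λ (α * r) 1 < cubicEnergy Λ (α * r) (S t)) :
    ¬ IsLocalMax (paramEnergy (gaussPotential α) 1) q := by
  intro hmax
  obtain ⟨p, hp, hE⟩ := hF.exists_path hS hsym hdet
  obtain ⟨t, ht, ht2, ht3⟩ := ((hp.eventually hmax).and ((hE α).and h)).exists
  rw [ht2, hF.paramEnergy_eq hF.mem, hF.frameForm_self] at ht
  exact absurd ht3 ht.not_gt

/-! ### The two cubic lattices -/

/-- The parameters of the face-centred cubic lattice. -/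
def fccParam : Fin 5 → ℝ := ![1, 1, 0, 1 / 2, 1 / 2]

theorem fccParam_mem : fccParam ∈ paramDomain := parametrizes_fcc.1

theorem frame_fcc : Frame fccSet fccParam (latConst 1 / 2) !![1, 1, 1; 1, -1, 0; 0, 0, 1] where
  mem := fccParam_mem
  pos := half_pos latConst_one_pos
  gram := by
    ext i j
    fin_cases i <;> fin_cases j <;>
      simp [gramMat, fccParam, Matrix.mul_apply, Fin.sum_univ_three] <;> ring
  mem_iff k := by
    constructor
    · rintro ⟨⟨m, hm⟩, hk⟩
      -- The preimage is integral because half the coordinate sum, `m`, is an integer.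
      have e : !![1, 1, 1; 1, -1, 0; 0, 0, 1] *ᵥ ![m - k 2, m - k 2 - k 1, k 2] = k := by
        ext i
        fin_cases i <;> simp [Matrix.mulVec, dotProduct, Fin.sum_univ_three] <;> omega
      refine ⟨_, fun h => hk ?_, e⟩
      rw [← e, h, Matrix.mulVec_zero]
    · rintro ⟨n, hn, rfl⟩
      refine ⟨⟨n 0 + n 2, ?_⟩, fun h => hn ?_⟩
      · simp [Matrix.mulVec, dotProduct, Fin.sum_univ_three]; ring
      · have h0 := congrFun h 0
        have h1 := congrFun h 1
        have h2 := congrFun h 2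
        simp [Matrix.mulVec, dotProduct, Fin.sum_univ_three] at h0 h1 h2
        ext i
        fin_cases i <;> simp <;> omega

theorem frame_bcc : Frame bccSet (dualParam fccParam) (latConst 1 ^ 2 / 4)
    !![2, -1, -1; 0, 1, 1; 0, 1, -1] where
  mem := dualParam_mem fccParam_mem
  pos := by have := latConst_one_pos; positivity
  gram := by
    have hC := latConst_one_pos
    have h3 := latConst_one_pow
    have h6 : latConst 1 ^ 6 = 4 := by
      rw [show latConst 1 ^ 6 = (latConst 1 ^ 3) ^ 2 by ring, h3]; norm_num
    ext i j
    fin_cases i <;> fin_cases j <;>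
      simp [gramMat, dualParam, fccParam, Matrix.mul_apply, Fin.sum_univ_three] <;> field_simp <;>
      simp only [h3, h6] <;> norm_num
  mem_iff k := by
    constructor
    · rintro ⟨hev, hk⟩
      obtain ⟨a, ha⟩ := hev 0 1
      obtain ⟨b, hb⟩ := hev 1 2
      have e : !![2, -1, -1; 0, 1, 1; 0, 1, -1] *ᵥ ![a, b, k 1 - b] = k := by
        ext i
        fin_cases i <;> simp [Matrix.mulVec, dotProduct, Fin.sum_univ_three] <;> omega
      refine ⟨_, fun h => hk ?_, e⟩
      rw [← e, h, Matrix.mulVec_zero]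
    · rintro ⟨n, hn, rfl⟩
      refine ⟨fun i j => ?_, fun h => hn ?_⟩
      · fin_cases i <;> fin_cases j <;>
          simp [Matrix.mulVec, dotProduct, Fin.sum_univ_three, parity_simps]
      · have h0 := congrFun h 0
        have h1 := congrFun h 1
        have h2 := congrFun h 2
        simp [Matrix.mulVec, dotProduct, Fin.sum_univ_three] at h0 h1 h2
        ext i
        fin_cases i <;> simp <;> omega

theorem Parametrizes.paramLattice {q q₁ : Fin 5 → ℝ} {L : Submodule ℤ E3} (h : Parametrizes 1 q L)
    (h₁ : Parametrizes 1 q₁ L) : Parametrizes 1 q (paramLattice 1 q₁) := by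
  obtain ⟨hq, O, hO⟩ := h
  obtain ⟨-, O₁, hO₁⟩ := h₁
  refine ⟨hq, O.trans O₁.symm, ?_⟩
  have e : ⇑(O.trans O₁.symm) = O₁.symm ∘ O := rfl
  rw [e, Set.image_comp, hO, ← hO₁, ← Set.image_comp]
  simp

theorem exists_fcc_isLocalMinimizer :
    ∃ α₁ > 0, ∀ α > α₁, IsLocalMinimizer (gaussPotential α) 1 (fcc 1) := by
  obtain ⟨β₁, hβ₁, h⟩ := exists_fcc_energy_le
  have hr := frame_fcc.pos
  refine ⟨β₁ / (latConst 1 / 2), by positivity, fun α hα => ⟨⟨_, parametrizes_fcc⟩, fun q hq => ?_⟩⟩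
  obtain ⟨P, hF⟩ := frame_fcc.exists_of_parametrizes hq
  obtain ⟨ε, hε, hK⟩ := h (α * (latConst 1 / 2)) ((div_lt_iff₀ hr).1 hα)
  exact hF.isLocalMin_paramEnergy hε hK

theorem exists_bcc_isSaddlePoint :
    ∃ α₁ > 0, ∀ α > α₁, IsSaddlePoint (gaussPotential α) 1 bcc := by
  obtain ⟨β₁, hβ₁, h₁⟩ := exists_bcc_energy_lt_shear
  obtain ⟨β₂, hβ₂, h₂⟩ := exists_bcc_energy_diag_lt
  have hr := frame_bcc.pos
  have hb : Parametrizes 1 (dualParam fccParam) bcc := parametrizes_fcc.dual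
  refine ⟨max β₁ β₂ / (latConst 1 ^ 2 / 4), by positivity, fun α hα => ⟨⟨_, hb⟩, fun q hq => ?_⟩⟩
  obtain ⟨P, hF⟩ := frame_bcc.exists_of_parametrizes (hq.paramLattice hb)
  have hα0 : 0 < α := lt_trans (by positivity) hα
  have hβ := (div_lt_iff₀ hr).1 hα
  refine ⟨hF.hasFDerivAt_paramEnergy isCubic_bccSet hα0,
    hF.not_isLocalMin tendsto_one_add_diagDir ?_ ?_ (h₂ _ ((le_max_right _ _).trans_lt hβ)),
    hF.not_isLocalMax tendsto_one_add_shearDir ?_ ?_ (h₁ _ ((le_max_left _ _).trans_lt hβ))⟩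
  · exact .of_forall fun t => Matrix.isSymm_one.add (isSymm_diagDir t)
  · filter_upwards [self_mem_nhdsWithin] with t ht using det_one_add_diagDir ht
  · exact .of_forall fun t => Matrix.isSymm_one.add (isSymm_shearDir t)
  · exact .of_forall fun t => det_one_add_shearDir t

/-! ### Passing between FCC and BCC by duality -/

theorem dualLattice_bcc : dualLattice bcc = fcc 1 := dualLattice_dualLattice parametrizes_fcc

theorem bcc_isSaddlePoint_of_fcc {α₀ : ℝ} (hα₀ : 0 < α₀)
    (h : ∀ α : ℝ, 0 < α → α < α₀ → IsSaddlePoint (gaussPotential α) 1 (fcc 1)) {α : ℝ}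
    (hα : π ^ 2 / α₀ < α) : IsSaddlePoint (gaussPotential α) 1 bcc := by
  have hπ := Real.pi_pos
  have hα0 : 0 < α := lt_trans (by positivity) hα
  exact (h (π ^ 2 / α) (by positivity) ((div_lt_comm₀ hα₀ hα0).1 hα)).dual hα0

theorem bcc_isLocalMinimizer_of_fcc {α₁ : ℝ} (hα₁ : 0 < α₁)
    (h : ∀ α : ℝ, α₁ < α → IsLocalMinimizer (gaussPotential α) 1 (fcc 1)) {α : ℝ}
    (hα0 : 0 < α) (hα : α < π ^ 2 / α₁) : IsLocalMinimizer (gaussPotential α) 1 bcc :=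
  (h (π ^ 2 / α) ((lt_div_comm₀ hα0 hα₁).1 hα)).dual hα0

end CubicLattices

end

theorem corollary5p5 :
    -- constants as in the FCC statement exist for which the BCC statement holds with inverses
    (∃ α₀ α₁ : ℝ, 0 < α₀ ∧ 0 < α₁ ∧
      (∀ α : ℝ, 0 < α → α < α₀ →
        CubicLattices.IsSaddlePoint (CubicLattices.gaussPotential α) 1 (CubicLattices.fcc 1)) ∧
      (∀ α : ℝ, α₁ < α →
        CubicLattices.IsLocalMinimizer (CubicLattices.gaussPotential α) 1
          (CubicLattices.fcc 1)) ∧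
      (∀ α : ℝ, 1 / α₀ < α →
        CubicLattices.IsSaddlePoint (CubicLattices.gaussPotential α) 1 CubicLattices.bcc) ∧
      (∀ α : ℝ, 0 < α → α < 1 / α₁ →
        CubicLattices.IsLocalMinimizer (CubicLattices.gaussPotential α) 1
          CubicLattices.bcc)) ∧
    -- every constant as in the FCC statement gives one for BCC, by the duality `α ↦ π² / α`
    (∀ α₀ : ℝ, 0 < α₀ →
      (∀ α : ℝ, 0 < α → α < α₀ →
        CubicLattices.IsSaddlePoint (CubicLattices.gaussPotential α) 1 (CubicLattices.fcc 1)) →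
      ∀ α : ℝ, Real.pi ^ 2 / α₀ < α →
        CubicLattices.IsSaddlePoint (CubicLattices.gaussPotential α) 1 CubicLattices.bcc) ∧
    (∀ α₁ : ℝ, 0 < α₁ →
      (∀ α : ℝ, α₁ < α →
        CubicLattices.IsLocalMinimizer (CubicLattices.gaussPotential α) 1
          (CubicLattices.fcc 1)) →
      ∀ α : ℝ, 0 < α → α < Real.pi ^ 2 / α₁ →
        CubicLattices.IsLocalMinimizer (CubicLattices.gaussPotential α) 1
          CubicLattices.bcc) := by
  refine ⟨?_, fun α₀ hα₀ h α hα => CubicLattices.bcc_isSaddlePoint_of_fcc hα₀ h hα,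
    fun α₁ hα₁ h α hα0 hα => CubicLattices.bcc_isLocalMinimizer_of_fcc hα₁ h hα0 hα⟩
  obtain ⟨a, ha, hsad⟩ := CubicLattices.exists_bcc_isSaddlePoint
  obtain ⟨α₁, hα₁, hmin⟩ := CubicLattices.exists_fcc_isLocalMinimizer
  have hπ2 : 1 ≤ Real.pi ^ 2 := by nlinarith [Real.pi_gt_three]
  -- With `a` the BCC saddle threshold, `α < 1/a` gives `π²/α > a` because `π² ≥ 1`, so FCC is a
  -- saddle by duality; and `1/α₀ = a` returns the original BCC range.
  refine ⟨1 / a, α₁, by positivity, hα₁, fun α hα0 hα => ?_, hmin, fun α hα => ?_,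
    fun α hα0 hα => ?_⟩
  · have h : a < Real.pi ^ 2 / α := by
      rw [lt_div_iff₀ hα0]
      rw [lt_div_iff₀ ha] at hα
      linarith
    have := (hsad _ h).dual hα0
    rwa [CubicLattices.dualLattice_bcc] at this
  · exact hsad α (by rwa [one_div_one_div] at hα)
  · exact CubicLattices.bcc_isLocalMinimizer_of_fcc hα₁ hmin hα0
      (hα.trans_le (by gcongr))
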